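/- For $N\ge 1$ let $B$ be the unit ball of $\mathbb R^N$, $|B|$ its volume, and let $\mu_2(B)$ be the first nontrivial eigenvalue of the Neumann problem $\Delta f+\mu f=0$ in $B$, $\langle\nabla f,\eta\rangle=0$ on $\partial B$ ($\eta$ the outer unit normal), that is, the smallest $\mu>0$ for which this problem has a nonzero classical solution $f\in C^2(B)\cap C^1(\overline B)$. A normalized radial profile in dimension $N$ is a function $\varphi$, continuous on $[0,1]$ and $C^2$ on $(0,1)$, with $$\varphi''+\frac{N-1}{t}\varphi'+\Bigl(\mu_2(B)-\frac{N-1}{t^2}\Bigr)\varphi=0\ \text{ on }(0,1),\qquad \varphi(0)=\varphi'(1)=0,\qquad \int_0^1\varphi^2(t)\,t^{N-1}\,dt=\frac1{|B|}$$ (where $\varphi'(1)$ is the one-sided derivative). Put $$\gamma_N=\frac{2\mu_2(B)+(N+2)(N-2)-(N+2)|B|\varphi^2(1)}{6N(N+2)\mu_2(B)}.$$ For every $N\ge1$, the eigenvalue $\mu_2(B)$ exists, and there is a normalized radial profile $\varphi$ such that the functions $x\mapsto\varphi(|x|)\frac{x_i}{|x|}$ (with value $0$ at $x=0$), $i=1,\dots,N$,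 are eigenfunctions for $\mu_2(B)$. Moreover: (i) $\mu_2(B)\ge N+1$ for every $N\ge1$; $\mu_2(B)<N+2$ for $N=2,3,4$; and $\mu_2(B)<\frac{N(N-1)}{N-2}$ for $N\ge5$. (ii) $|B|\varphi^2(1)=\frac{2\mu_2(B)}{\mu_2(B)-N+1}$ for every $N\ge1$ and every normalized radial profile $\varphi$ in dimension $N$. (iii) $\gamma_N<0$ for every $N\ge2$ and every normalized radial profile $\varphi$ in dimension $N$. (iv) $\gamma_N\to0$ as $N\to\infty$, for every choice of normalized radial profiles $\varphi=\varphi_N$, $N\ge2$. -/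

import Mathlib

open Set Filter Topology MeasureTheory

namespace SzegoWeinberger

/-- The volume `|B|` of the unit ball `B` of `ℝ^N`. -/
noncomputable def ballVol (N : ℕ) : ℝ :=
  volume.real (Metric.ball (0 : EuclideanSpace ℝ (Fin N)) 1)

/-- `f` is an eigenfunction for the eigenvalue `μ` of the Neumann problem
`Δ f + μ f = 0` in `B`, `⟨∇ f, η⟩ = 0` on `∂B` on the unit ball `B` of `ℝ^N`: a nontrivial
classical solution, of class `C²` in `B` and `C¹` on the closed ball. The outer unit normal
at a point `x` of the unit sphere is `η = x`. Values of `f` outside the closed ball are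
irrelevant. -/
structure IsNeumannEigenfunction (N : ℕ) (μ : ℝ) (f : EuclideanSpace ℝ (Fin N) → ℝ) :
    Prop where
  nontrivial : ∃ x ∈ Metric.ball (0 : EuclideanSpace ℝ (Fin N)) 1, f x ≠ 0
  contDiffOn_ball : ContDiffOn ℝ 2 f (Metric.ball 0 1)
  contDiffOn_closedBall : ContDiffOn ℝ 1 f (Metric.closedBall 0 1)
  equation : ∀ x ∈ Metric.ball (0 : EuclideanSpace ℝ (Fin N)) 1,
    Laplacian.laplacian f x + μ * f x = 0
  boundary : ∀ x ∈ Metric.sphere (0 : EuclideanSpace ℝ (Fin N)) 1,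
    fderivWithin ℝ f (Metric.closedBall 0 1) x x = 0

/-- The set of positive (that is, nontrivial) Neumann eigenvalues of `-Δ` on the unit ball. -/
def posNeumannEigenvalues (N : ℕ) : Set ℝ :=
  {μ | 0 < μ ∧ ∃ f, IsNeumannEigenfunction N μ f}

/-- `μ₂(B)`: the first nontrivial Neumann eigenvalue of `-Δ` on the unit ball of `ℝ^N`. -/
noncomputable def mu2 (N : ℕ) : ℝ := sInf (posNeumannEigenvalues N)

/-- `φ` is the normalized radial profile of the `μ₂(B)`-eigenfunctions
`x ↦ φ(|x|) x_i / |x|`. It is continuous on `[0,1]`, of class `C²` on `(0,1)`, and satisfies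
`φ'' + (N-1)/t φ' + (μ₂(B) - (N-1)/t²) φ = 0` on `(0,1)`, `φ(0) = φ'(1) = 0` and
`∫₀¹ φ² t^(N-1) dt = 1/|B|`. These conditions determine `φ` up to its sign. -/
structure IsRadialProfile (N : ℕ) (φ : ℝ → ℝ) : Prop where
  continuousOn : ContinuousOn φ (Icc 0 1)
  contDiffOn : ContDiffOn ℝ 2 φ (Ioo 0 1)
  equation : ∀ t ∈ Ioo (0 : ℝ) 1,
    deriv (deriv φ) t + ((N : ℝ) - 1) / t * deriv φ t
      + (mu2 N - ((N : ℝ) - 1) / t ^ 2) * φ t = 0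
  apply_zero : φ 0 = 0
  deriv_one : HasDerivWithinAt φ 0 (Icc 0 1) 1
  normalized : ∫ t in (0 : ℝ)..1, φ t ^ 2 * t ^ (N - 1) = 1 / ballVol N

/-- The coefficient `γ_N`, where `φ` is the normalized radial profile in dimension `N`. -/
noncomputable def gammaCoeff (N : ℕ) (φ : ℝ → ℝ) : ℝ :=
  (2 * mu2 N + ((N : ℝ) + 2) * ((N : ℝ) - 2) - ((N : ℝ) + 2) * ballVol N * φ 1 ^ 2) /
    (6 * (N : ℝ) * ((N : ℝ) + 2) * mu2 N)

end SzegoWeinberger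

/-!
The regular solution of `φ'' + (N-1)/r φ' + (μ - (N-1)/r²) φ = 0` is `φ = r G(μ r²)`, where `G`
(`radialSeries N`) is a Bessel-type entire function, and `φ'(r) = D(μ r²)` with `D = G + 2 s G'`
(`slopeSeries N`). The eigenvalue `μ₂(B)` is the first positive zero `m` of `D` (`firstZero N`).

*The value `m` is attained.* For `μ = m` the functions `x_i G(μ|x|²)` solve the Helmholtz equation
and their normal derivative is `x_i D(m) = 0`.

*Nothing lies below `m`* (`IsNeumannEigenfunction.firstZero_le`). Spherical harmonics are avoided by
a reflection argument. If `0 < μ < m`, then `⟨e, x⟩ G(μ|x|²)` is a positive solution on the half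
ball `⟨e, x⟩ > 0` with positive outer normal derivative. For an eigenfunction `f` and the reflection
`R` in `e^⊥`, the difference `f - f ∘ R` vanishes on the mirror, and the maximum principle for its
quotient by (a perturbation of) this positive solution shows that it vanishes. Hence `f` is radial
(`IsNeumannEigenfunction.le_of_norm_eq`), and a radial `f` is excluded by a Wronskian with the
regular radial solution.

*Bounds for `m`.* The ratio `z = 1 - D / G` satisfies the Riccati equation
`2 s z' + N z = s + z²`, so its power series has positive coefficients, and `z < 1` on `(0, m)`.
Three terms of this series give the upper bounds (`riccati_partial_sum_le_one`). The lower bound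
`N + 1` comes from a comparison with `r exp (-r²/2)` (`add_one_le_firstZero`).

*The coefficient.* Every normalized profile is a multiple of `φ`
(`IsRadialProfile.eq_mul_radialMode`), Lommel's integral (`integral_radialMode_sq`) then gives
`|B| φ(1)²`, and the sign and the limit of `γ_N` follow from the bounds for `m`.
-/

open Set Filter Topology MeasureTheory

namespace SzegoWeinberger

/-! ### The radial solution as a power series -/

/-- Coefficients of the entire function `radialSeries N`. -/
noncomputable def radialCoeff (N k : ℕ) : ℝ :=
  (-1) ^ k / (2 ^ k * (k.factorial : ℝ) * ∏ j ∈ Finset.range k, ((N : ℝ) + 2 * ((j : ℝ) + 1)))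

/-- The normalized Bessel function `∑ (-s)^k / (2^k k! (N+2)(N+4)⋯(N+2k))`. -/
noncomputable def radialSeries (N : ℕ) (s : ℝ) : ℝ := ∑' k, radialCoeff N k * s ^ k

lemma prod_radial_pos (N k : ℕ) :
    0 < ∏ j ∈ Finset.range k, ((N : ℝ) + 2 * ((j : ℝ) + 1)) :=
  Finset.prod_pos fun j _ => by positivity

lemma prod_radial_shift (N k : ℕ) :
    ∏ j ∈ Finset.range (k + 1), ((N : ℝ) + 2 * ((j : ℝ) + 1)) =
      ((N : ℝ) + 2) * ∏ j ∈ Finset.range k, (((N + 2 : ℕ) : ℝ) + 2 * ((j : ℝ) + 1)) := by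
  rw [Finset.prod_range_succ']
  push_cast
  rw [mul_comm]
  congr 1
  · ring
  · exact Finset.prod_congr rfl fun j _ => by ring

lemma radialCoeff_succ_shift (N k : ℕ) :
    ((k : ℝ) + 1) * radialCoeff N (k + 1) =
      -(1 / (2 * ((N : ℝ) + 2))) * radialCoeff (N + 2) k := by
  have h1 := (prod_radial_pos (N + 2) k).ne'
  have h2 : (N : ℝ) + 2 ≠ 0 := by positivity
  have h3 : (k.factorial : ℝ) ≠ 0 := by positivity
  have h4 : (k : ℝ) + 1 ≠ 0 := by positivity
  unfold radialCoeff
  rw [prod_radial_shift, Nat.factorial_succ, pow_succ, pow_succ]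
  push_cast at h1 ⊢
  field_simp

lemma abs_radialCoeff_le (N k : ℕ) : |radialCoeff N k| ≤ 1 / (k.factorial : ℝ) := by
  unfold radialCoeff
  rw [abs_div, abs_pow, abs_neg, abs_one, one_pow]
  have h1 : 1 ≤ ∏ j ∈ Finset.range k, ((N : ℝ) + 2 * ((j : ℝ) + 1)) := by
    refine Finset.one_le_prod fun j _ => ?_
    have : (0 : ℝ) ≤ N := N.cast_nonneg
    have : (0 : ℝ) ≤ j := j.cast_nonneg
    linarith
  have h2 : (1 : ℝ) ≤ 2 ^ k := one_le_pow₀ (by norm_num)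
  have h3 : (0 : ℝ) < k.factorial := by positivity
  rw [abs_of_pos (by positivity)]
  apply one_div_le_one_div_of_le h3
  nlinarith [mul_le_mul_of_nonneg_right h2 h3.le, mul_le_mul_of_nonneg_left h1
    (by positivity : 0 ≤ (2:ℝ) ^ k * k.factorial)]

lemma summable_radialCoeff_mul_pow (N : ℕ) (s : ℝ) :
    Summable fun k => radialCoeff N k * s ^ k := by
  refine Summable.of_norm_bounded (Real.summable_pow_div_factorial |s|) fun k => ?_
  rw [Real.norm_eq_abs, abs_mul, abs_pow]
  calc |radialCoeff N k| * |s| ^ k ≤ 1 / (k.factorial : ℝ) * |s| ^ k := by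
        gcongr; exact abs_radialCoeff_le N k
    _ = _ := by ring

lemma radialSeries_zero (N : ℕ) : radialSeries N 0 = 1 := by
  unfold radialSeries
  rw [tsum_eq_single 0 (fun k hk => by simp [hk])]
  simp [radialCoeff]

lemma summable_radialCoeff_deriv (N : ℕ) (R : ℝ) :
    Summable fun k : ℕ => |radialCoeff N k * ((k : ℝ) * R ^ (k - 1))| := by
  rw [← summable_nat_add_iff 1]
  have h := ((summable_radialCoeff_mul_pow (N + 2) R).mul_left (-(1 / (2 * ((N : ℝ) + 2))))).abs
  refine h.congr fun k => ?_
  rw [← mul_assoc, ← radialCoeff_succ_shift]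
  push_cast
  congr 1
  ring

/-- Differentiation shifts the dimension by two. -/
lemma hasDerivAt_radialSeries (N : ℕ) (s : ℝ) :
    HasDerivAt (radialSeries N) (-(1 / (2 * ((N : ℝ) + 2))) * radialSeries (N + 2) s) s := by
  have hs : s ∈ Metric.ball (0 : ℝ) (|s| + 1) := by simp
  have key := hasDerivAt_tsum_of_isPreconnected (𝕜 := ℝ)
    (g := fun k z => radialCoeff N k * z ^ k)
    (g' := fun k z => radialCoeff N k * ((k : ℝ) * z ^ (k - 1)))
    (summable_radialCoeff_deriv N (|s| + 1)) Metric.isOpen_ball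
    (convex_ball (0 : ℝ) (|s| + 1)).isPreconnected
    (fun k y _ => (hasDerivAt_pow k y).const_mul _) (fun k y hy => ?_) hs
    (summable_radialCoeff_mul_pow N s) hs
  · refine HasDerivAt.congr_deriv (f := radialSeries N) key ?_
    have hsum : Summable fun k : ℕ => radialCoeff N k * ((k : ℝ) * s ^ (k - 1)) :=
      (summable_radialCoeff_deriv N s).of_abs
    rw [hsum.tsum_eq_zero_add, radialSeries, ← tsum_mul_left]
    simp only [Nat.cast_zero, zero_mul, mul_zero, zero_add, Nat.add_sub_cancel]
    refine tsum_congr fun k => ?_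
    rw [← mul_assoc (-(1 / _)), ← radialCoeff_succ_shift]
    push_cast
    ring
  · have hy' : |y| ≤ |s| + 1 := by
      simpa using (mem_ball_zero_iff.1 hy).le
    rw [Real.norm_eq_abs, abs_mul, abs_mul, abs_mul, abs_mul, abs_pow, abs_pow]
    rw [abs_of_nonneg (by positivity : 0 ≤ |s| + 1)]
    gcongr

lemma continuous_radialSeries (N : ℕ) : Continuous (radialSeries N) :=
  continuous_iff_continuousAt.2 fun s => (hasDerivAt_radialSeries N s).continuousAt

lemma contDiff_radialSeries (n N : ℕ) : ContDiff ℝ n (radialSeries N) := by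
  induction n generalizing N with
  | zero => exact contDiff_zero.2 (continuous_radialSeries N)
  | succ n ih =>
    have hd : deriv (radialSeries N) =
        fun s => -(1 / (2 * ((N : ℝ) + 2))) * radialSeries (N + 2) s :=
      funext fun s => (hasDerivAt_radialSeries N s).deriv
    push_cast
    rw [contDiff_succ_iff_deriv]
    refine ⟨fun s => (hasDerivAt_radialSeries N s).differentiableAt, by simp, ?_⟩
    rw [hd]
    exact contDiff_const.mul (ih _)

/-- The three-term recurrence of Bessel functions, which encodes the differential equation. -/
lemma radialSeries_recurrence (N : ℕ) (s : ℝ) :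
    radialSeries N s = radialSeries (N + 2) s -
      s / (((N : ℝ) + 2) * ((N : ℝ) + 4)) * radialSeries (N + 4) s := by
  have h0 := summable_radialCoeff_mul_pow N s
  have h2 := summable_radialCoeff_mul_pow (N + 2) s
  have h4 := summable_radialCoeff_mul_pow (N + 4) s
  have key : ∀ k, radialCoeff N (k + 1) - radialCoeff (N + 2) (k + 1) =
      -(1 / (((N : ℝ) + 2) * ((N : ℝ) + 4))) * radialCoeff (N + 4) k := by
    intro k
    have hk : (k : ℝ) + 1 ≠ 0 := by positivity
    have hN2 : (N : ℝ) + 2 ≠ 0 := by positivity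
    have hN4 : (N : ℝ) + 4 ≠ 0 := by positivity
    have hA := radialCoeff_succ_shift N k
    have hB := radialCoeff_succ_shift (N + 2) k
    have hC : radialCoeff (N + 2) k * ((N : ℝ) + 4) =
        radialCoeff (N + 4) k * ((N : ℝ) + 2 * (k + 2)) := by
      have hp := prod_radial_shift (N + 2) k
      rw [Finset.prod_range_succ] at hp
      have h1 := (prod_radial_pos (N + 2) k).ne'
      have h2 := (prod_radial_pos (N + 4) k).ne'
      unfold radialCoeff
      rw [div_mul_eq_mul_div, div_mul_eq_mul_div, div_eq_div_iff (by positivity) (by positivity)]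
      push_cast at hp ⊢
      have e4 : ((N : ℝ) + 2 + 2) = N + 4 := by ring
      rw [e4] at hp
      linear_combination (-(1:ℝ)) ^ k * 2 ^ k * (k.factorial : ℝ) * (-1 : ℝ) * hp
    push_cast at hB
    have hB' : ((k : ℝ) + 1) * radialCoeff (N + 2) (k + 1) =
      -(1 / (2 * ((N : ℝ) + 4))) * radialCoeff (N + 4) k := by
      rw [hB]; congr 3; ring
    apply mul_left_cancel₀ hk
    rw [mul_sub, hA, hB']
    have hC' : radialCoeff (N + 2) k =
        radialCoeff (N + 4) k * ((N : ℝ) + 2 * (k + 2)) / ((N : ℝ) + 4) := by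
      rw [← hC]; field_simp
    rw [hC']
    field_simp
    ring
  have h00 : radialCoeff N 0 = 1 := by simp [radialCoeff]
  have h20 : radialCoeff (N + 2) 0 = 1 := by simp [radialCoeff]
  have hs0 := (summable_nat_add_iff 1).2 h0
  have hs2 := (summable_nat_add_iff 1).2 h2
  have : radialSeries N s - radialSeries (N + 2) s =
      -(s / (((N : ℝ) + 2) * ((N : ℝ) + 4))) * radialSeries (N + 4) s := by
    unfold radialSeries
    rw [h0.tsum_eq_zero_add, h2.tsum_eq_zero_add, h00, h20, pow_zero, add_sub_add_left_eq_sub,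
      ← hs0.tsum_sub hs2, ← tsum_mul_left]
    refine tsum_congr fun k => ?_
    rw [← sub_mul, key k]
    ring
  linarith

/-- The function `G + 2 s G'` for `G = radialSeries N`: then `d/dr (r G(μ r²)) = D(μ r²)`. -/
noncomputable def slopeSeries (N : ℕ) (s : ℝ) : ℝ :=
  radialSeries N s - s / ((N : ℝ) + 2) * radialSeries (N + 2) s

lemma slopeSeries_zero (N : ℕ) : slopeSeries N 0 = 1 := by
  simp [slopeSeries, radialSeries_zero]

lemma hasDerivAt_slopeSeries (N : ℕ) (s : ℝ) :
    HasDerivAt (slopeSeries N)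
      ((((N : ℝ) - 1) / ((N : ℝ) + 2) * radialSeries (N + 2) s - radialSeries N s) / 2) s := by
  have h := (hasDerivAt_radialSeries N s).sub
    (((hasDerivAt_id s).div_const ((N : ℝ) + 2)).mul (hasDerivAt_radialSeries (N + 2) s))
  refine h.congr_deriv ?_
  have hN2 : (N : ℝ) + 2 ≠ 0 := by positivity
  have hN4 : (N : ℝ) + 4 ≠ 0 := by positivity
  have hr := radialSeries_recurrence N s
  push_cast
  rw [hr]
  have e4 : ((N : ℝ) + 2 + 2) = N + 4 := by ring
  simp only [id_eq, e4]
  field_simp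
  ring

lemma continuous_slopeSeries (N : ℕ) : Continuous (slopeSeries N) :=
  continuous_iff_continuousAt.2 fun s => (hasDerivAt_slopeSeries N s).continuousAt

/-! ### The first zero of the slope -/

/-- The regular solution `r G(μ r²)` of `φ'' + (N-1)/r φ' + (μ - (N-1)/r²) φ = 0`, with slope `1`
at the origin. -/
noncomputable def radialMode (N : ℕ) (μ r : ℝ) : ℝ := r * radialSeries N (μ * r ^ 2)

lemma hasDerivAt_mul_sq (μ r : ℝ) : HasDerivAt (fun r : ℝ => μ * r ^ 2) (2 * μ * r) r := by
  refine ((hasDerivAt_pow 2 r).const_mul μ).congr_deriv ?_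
  norm_num; ring

lemma hasDerivAt_radialSeries_mul_sq (N : ℕ) (μ r : ℝ) :
    HasDerivAt (fun r => radialSeries N (μ * r ^ 2))
      (-(μ * r / ((N : ℝ) + 2)) * radialSeries (N + 2) (μ * r ^ 2)) r := by
  refine ((hasDerivAt_radialSeries N (μ * r ^ 2)).comp r (hasDerivAt_mul_sq μ r)).congr_deriv ?_
  have : (N : ℝ) + 2 ≠ 0 := by positivity
  field_simp

lemma hasDerivAt_slopeSeries_mul_sq (N : ℕ) (μ r : ℝ) :
    HasDerivAt (fun r => slopeSeries N (μ * r ^ 2))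
      (μ * r * (((N : ℝ) - 1) / ((N : ℝ) + 2) * radialSeries (N + 2) (μ * r ^ 2)
        - radialSeries N (μ * r ^ 2))) r := by
  refine ((hasDerivAt_slopeSeries N (μ * r ^ 2)).comp r (hasDerivAt_mul_sq μ r)).congr_deriv ?_
  ring

lemma hasDerivAt_radialMode (N : ℕ) (μ r : ℝ) :
    HasDerivAt (radialMode N μ) (slopeSeries N (μ * r ^ 2)) r := by
  refine ((hasDerivAt_id r).mul (hasDerivAt_radialSeries_mul_sq N μ r)).congr_deriv ?_
  simp only [id_eq, slopeSeries]
  ring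

lemma continuous_radialMode (N : ℕ) (μ : ℝ) : Continuous (radialMode N μ) :=
  continuous_iff_continuousAt.2 fun s => (hasDerivAt_radialMode N μ s).continuousAt

lemma contDiff_radialMode (n N : ℕ) (μ : ℝ) : ContDiff ℝ n (radialMode N μ) :=
  contDiff_id.mul ((contDiff_radialSeries n N).comp (contDiff_const.mul (contDiff_id.pow 2)))

/-- Where the slope is positive, `t G(t²)` increases from `0`. -/
lemma radialSeries_pos_of_slopeSeries_pos {N : ℕ} {b : ℝ}
    (h : ∀ s ∈ Ioo 0 b, 0 < slopeSeries N s) {s : ℝ} (hs : s ∈ Icc 0 b) :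
    0 < radialSeries N s := by
  rcases hs.1.eq_or_lt with rfl | hs0
  · rw [radialSeries_zero]; exact one_pos
  have hmono : StrictMonoOn (radialMode N 1) (Icc 0 √b) := by
    refine strictMonoOn_of_deriv_pos (convex_Icc _ _) (continuous_radialMode N 1).continuousOn ?_
    intro t ht
    rw [interior_Icc] at ht
    rw [(hasDerivAt_radialMode N 1 t).deriv, one_mul]
    exact h _ ⟨by have := ht.1; positivity, (Real.lt_sqrt ht.1.le).1 ht.2⟩
  have h1 := hmono ⟨le_rfl, Real.sqrt_nonneg _⟩ ⟨Real.sqrt_nonneg s, Real.sqrt_le_sqrt hs.2⟩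
    (Real.sqrt_pos.2 hs0)
  simp only [radialMode, zero_mul, one_mul, Real.sq_sqrt hs.1] at h1
  exact pos_of_mul_pos_right h1 (Real.sqrt_nonneg s)

/-- A comparison principle for the Euler operator `2 s d/ds + N`: its multiple
`t ^ (N - 1) (2 s E' + N E)`, `s = t²`, is the derivative of `t ^ N E(t²)`. -/
lemma nonneg_of_euler_nonneg {N : ℕ} (hN : 1 ≤ N) {E E' : ℝ → ℝ} {b : ℝ}
    (hE : ∀ s ∈ Icc 0 b, HasDerivAt E (E' s) s)
    (h : ∀ s ∈ Icc 0 b, 0 ≤ 2 * s * E' s + N * E s) {s : ℝ} (hs : s ∈ Icc 0 b) : 0 ≤ E s := by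
  have hN' : (0 : ℝ) < N := by exact_mod_cast hN
  rcases hs.1.eq_or_lt with rfl | hs0
  · have := h 0 hs
    rw [mul_zero, zero_mul, zero_add] at this
    exact nonneg_of_mul_nonneg_right this hN'
  have hb : 0 ≤ b := hs.1.trans hs.2
  have hmem : ∀ t ∈ Icc 0 √b, t ^ 2 ∈ Icc 0 b := fun t ht =>
    ⟨by positivity, (pow_le_pow_left₀ ht.1 ht.2 2).trans_eq (Real.sq_sqrt hb)⟩
  have hd : ∀ t ∈ Icc 0 √b, HasDerivAt (fun t => t ^ N * E (t ^ 2))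
      (t ^ (N - 1) * (2 * t ^ 2 * E' (t ^ 2) + N * E (t ^ 2))) t := by
    intro t ht
    refine ((hasDerivAt_pow N t).mul
      (HasDerivAt.comp (h := fun t : ℝ => t ^ 2) t (hE _ (hmem t ht))
        (hasDerivAt_pow 2 t))).congr_deriv ?_
    obtain ⟨n, rfl⟩ : ∃ n, N = n + 1 := ⟨N - 1, by omega⟩
    simp only [Function.comp_apply, Nat.add_sub_cancel, pow_succ]
    push_cast
    ring
  have hmono : MonotoneOn (fun t => t ^ N * E (t ^ 2)) (Icc 0 √b) := by
    refine monotoneOn_of_deriv_nonneg (convex_Icc _ _)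
      (fun t ht => (hd t ht).continuousAt.continuousWithinAt)
      (fun t ht => (hd t (interior_subset ht)).differentiableAt.differentiableWithinAt) ?_
    intro t ht
    have ht' := interior_subset ht
    rw [(hd t ht').deriv]
    exact mul_nonneg (pow_nonneg ht'.1 _) (h _ (hmem t ht'))
  have h1 := hmono ⟨le_rfl, Real.sqrt_nonneg _⟩ ⟨Real.sqrt_nonneg s, Real.sqrt_le_sqrt hs.2⟩
    (Real.sqrt_nonneg s)
  simp only [Real.sq_sqrt hs.1, zero_pow (by omega : N ≠ 0), zero_mul] at h1
  exact nonneg_of_mul_nonneg_right h1 (pow_pos (Real.sqrt_pos.2 hs0) N)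

/-- If the slope stays positive on `(0, b)`, the ratio `z = 1 - D / G`, which solves the Riccati
equation `2 s z' + N z = s + z²`, is at most `1` at `b` and at least the sum of the first three
terms of its power series, all of whose coefficients are positive. -/
lemma riccati_partial_sum_le_one {N : ℕ} (hN : 1 ≤ N) {b : ℝ} (hb : 0 < b)
    (hD : ∀ s ∈ Ioo 0 b, 0 < slopeSeries N s) :
    b / (N + 2) + b ^ 2 / ((N + 2) ^ 2 * (N + 4))
      + 2 * b ^ 3 / ((N + 2) ^ 3 * (N + 4) * (N + 6)) ≤ 1 := by
  have hN2 : (N : ℝ) + 2 ≠ 0 := by positivity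
  have hN4 : (N : ℝ) + 4 ≠ 0 := by positivity
  have hN6 : (N : ℝ) + 6 ≠ 0 := by positivity
  have hG : ∀ s ∈ Icc 0 b, radialSeries N s ≠ 0 := fun s hs =>
    (radialSeries_pos_of_slopeSeries_pos hD hs).ne'
  set z : ℝ → ℝ := fun s => 1 - slopeSeries N s / radialSeries N s with hz
  obtain ⟨z', hz'⟩ : ∃ z' : ℝ → ℝ, ∀ s ∈ Icc 0 b,
      HasDerivAt z (z' s) s ∧ 2 * s * z' s + N * z s = s + z s ^ 2 := by
    refine ⟨_, fun s hs => ⟨((hasDerivAt_slopeSeries N s).div (hasDerivAt_radialSeries N s)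
      (hG s hs)).const_sub 1, ?_⟩⟩
    have := hG s hs
    simp only [hz, slopeSeries]
    field_simp
    ring
  have hlin : ∀ (c : ℝ) (n : ℕ) (s : ℝ),
      HasDerivAt (fun s : ℝ => c * s ^ n) (c * (n * s ^ (n - 1))) s :=
    fun c n s => (hasDerivAt_pow n s).const_mul c
  set a₁ : ℝ := 1 / (N + 2) with ha₁
  set a₂ : ℝ := a₁ ^ 2 / (N + 4) with ha₂
  set a₃ : ℝ := 2 * a₁ * a₂ / (N + 6) with ha₃
  have ha₁0 : 0 < a₁ := by positivity
  have ha₂0 : 0 < a₂ := by positivity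
  have e₁ : a₁ * (N + 2) = 1 := by rw [ha₁]; field_simp
  have e₂ : a₂ * (N + 4) = a₁ ^ 2 := by rw [ha₂]; field_simp
  have e₃ : a₃ * (N + 6) = 2 * a₁ * a₂ := by rw [ha₃]; field_simp
  -- each lower bound for `z`, inserted into `z²`, yields the bound with one more term
  have h1 : ∀ s ∈ Icc 0 b, a₁ * s ^ 1 ≤ z s := fun s hs => sub_nonneg.1 <|
    nonneg_of_euler_nonneg hN (E := fun s => z s - a₁ * s ^ 1)
      (fun s hs => (hz' s hs).1.sub (hlin a₁ 1 s)) (fun s hs => by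
      have hr := (hz' s hs).2
      norm_num
      linear_combination sq_nonneg (z s) - hr + s * e₁) hs
  have h2 : ∀ s ∈ Icc 0 b, a₁ * s ^ 1 + a₂ * s ^ 2 ≤ z s := fun s hs => sub_nonneg.1 <|
    nonneg_of_euler_nonneg hN (E := fun s => z s - (a₁ * s ^ 1 + a₂ * s ^ 2))
      (fun s hs => (hz' s hs).1.sub ((hlin a₁ 1 s).add (hlin a₂ 2 s))) (fun s hs => by
      have hr := (hz' s hs).2
      have hsq : (a₁ * s ^ 1) ^ 2 ≤ z s ^ 2 :=
        pow_le_pow_left₀ (by have := hs.1; positivity) (h1 s hs) 2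
      norm_num
      linear_combination hsq - hr + s * e₁ + s ^ 2 * e₂) hs
  have h3 : ∀ s ∈ Icc 0 b, a₁ * s ^ 1 + a₂ * s ^ 2 + a₃ * s ^ 3 ≤ z s := fun s hs =>
    sub_nonneg.1 <|
    nonneg_of_euler_nonneg hN (E := fun s => z s - (a₁ * s ^ 1 + a₂ * s ^ 2 + a₃ * s ^ 3))
      (fun s hs => (hz' s hs).1.sub (((hlin a₁ 1 s).add (hlin a₂ 2 s)).add (hlin a₃ 3 s)))
      (fun s hs => by
      have hr := (hz' s hs).2
      have hsq : (a₁ * s ^ 1 + a₂ * s ^ 2) ^ 2 ≤ z s ^ 2 :=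
        pow_le_pow_left₀ (by have := hs.1; positivity) (h2 s hs) 2
      have h4 : 0 ≤ (a₂ * s ^ 2) ^ 2 := sq_nonneg _
      norm_num
      linear_combination hsq - hr + s * e₁ + s ^ 2 * e₂ + s ^ 3 * e₃ + h4) hs
  have hDb : 0 ≤ slopeSeries N b := by
    have hcl : b ∈ closure (Ioo 0 b) := by rw [closure_Ioo hb.ne]; exact ⟨hb.le, le_rfl⟩
    exact closure_minimal (fun s hs => (hD s hs).le)
      (isClosed_le continuous_const (continuous_slopeSeries N)) hcl
  have hbb : b ∈ Icc 0 b := ⟨hb.le, le_rfl⟩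
  have hzb : z b ≤ 1 := by
    have := div_nonneg hDb (radialSeries_pos_of_slopeSeries_pos hD hbb).le
    simp only [hz]; linarith
  refine le_trans (le_of_eq ?_) ((h3 b hbb).trans hzb)
  rw [ha₃, ha₂, ha₁]
  field_simp

/-- The slope has a first positive zero, below `N + 2`. -/
lemma exists_first_zero {N : ℕ} (hN : 1 ≤ N) :
    ∃ m : ℝ, 0 < m ∧ slopeSeries N m = 0 ∧ ∀ s ∈ Ico 0 m, 0 < slopeSeries N s := by
  have hc := continuous_slopeSeries N
  obtain ⟨b, hb, hDb⟩ : ∃ b, 0 < b ∧ slopeSeries N b ≤ 0 := by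
    by_contra! hcon
    have h := riccati_partial_sum_le_one hN (b := N + 2) (by positivity) fun s hs => hcon s hs.1
    rw [div_self (by positivity)] at h
    have : (0 : ℝ) < ((N : ℝ) + 2) ^ 2 / (((N : ℝ) + 2) ^ 2 * (N + 4)) := by positivity
    have : (0 : ℝ) < 2 * ((N : ℝ) + 2) ^ 3 / (((N : ℝ) + 2) ^ 3 * (N + 4) * (N + 6)) := by
      positivity
    linarith
  set S : Set ℝ := Ici 0 ∩ slopeSeries N ⁻¹' {0} with hS
  have hScl : IsClosed S := isClosed_Ici.inter (isClosed_singleton.preimage hc)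
  have hivt : ∀ s, 0 ≤ s → slopeSeries N s ≤ 0 → ∃ t ∈ S, t ≤ s := by
    intro s hs hDs
    obtain ⟨t, ht, ht0⟩ := intermediate_value_Icc' hs hc.continuousOn
      (show (0 : ℝ) ∈ Icc _ _ from ⟨hDs, by rw [slopeSeries_zero]; exact zero_le_one⟩)
    exact ⟨t, ⟨ht.1, ht0⟩, ht.2⟩
  have hSne : S.Nonempty := by
    obtain ⟨t, ht, -⟩ := hivt b hb.le hDb
    exact ⟨t, ht⟩
  have hbdd : BddBelow S := ⟨0, fun t ht => ht.1⟩
  have hm := hScl.csInf_mem hSne hbdd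
  refine ⟨sInf S, lt_of_le_of_ne hm.1 fun h => ?_, hm.2, fun s hs => ?_⟩
  · have := hm.2
    rw [← h] at this
    simp [slopeSeries_zero] at this
  · by_contra! hle
    obtain ⟨t, ht, hts⟩ := hivt s hs.1 hle
    exact absurd (csInf_le hbdd ht) (not_le.2 (hts.trans_lt hs.2))

/-- The first positive zero of `slopeSeries N`; it equals `μ₂(B)` for `N ≥ 1`, see
`mu2_eq_firstZero`. -/
noncomputable def firstZero (N : ℕ) : ℝ := sInf {s | 0 < s ∧ slopeSeries N s = 0}

lemma isFirstZero {N : ℕ} (hN : 1 ≤ N) :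
    0 < firstZero N ∧ slopeSeries N (firstZero N) = 0 ∧
      ∀ s ∈ Ico 0 (firstZero N), 0 < slopeSeries N s := by
  obtain ⟨m, hm0, hm, hpos⟩ := exists_first_zero hN
  have hleast : IsLeast {s | 0 < s ∧ slopeSeries N s = 0} m :=
    ⟨⟨hm0, hm⟩, fun s hs => not_lt.1 fun hlt => (hpos s ⟨hs.1.le, hlt⟩).ne' hs.2⟩
  rw [firstZero, hleast.csInf_eq]
  exact ⟨hm0, hm, hpos⟩

lemma firstZero_lt {N : ℕ} (hN : 1 ≤ N) {b : ℝ} (hb : 0 < b)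
    (h : 1 < b / (N + 2) + b ^ 2 / ((N + 2) ^ 2 * (N + 4))
      + 2 * b ^ 3 / ((N + 2) ^ 3 * (N + 4) * (N + 6))) : firstZero N < b := by
  by_contra! hle
  exact absurd (riccati_partial_sum_le_one hN hb fun s hs =>
    (isFirstZero hN).2.2 s ⟨hs.1.le, hs.2.trans_le hle⟩) (not_le.2 h)

lemma firstZero_lt_add_two {N : ℕ} (hN : 1 ≤ N) : firstZero N < N + 2 := by
  refine firstZero_lt hN (by positivity) ?_
  rw [div_self (by positivity)]
  have : (0 : ℝ) < ((N : ℝ) + 2) ^ 2 / (((N : ℝ) + 2) ^ 2 * (N + 4)) := by positivity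
  have : (0 : ℝ) < 2 * ((N : ℝ) + 2) ^ 3 / (((N : ℝ) + 2) ^ 3 * (N + 4) * (N + 6)) := by
    positivity
  linarith

lemma firstZero_lt_div {N : ℕ} (hN : 5 ≤ N) :
    firstZero N < (N : ℝ) * ((N : ℝ) - 1) / ((N : ℝ) - 2) := by
  obtain ⟨k, rfl⟩ : ∃ k, N = k + 5 := ⟨N - 5, by omega⟩
  push_cast
  have hk : (0 : ℝ) ≤ k := k.cast_nonneg
  have e1 : (k : ℝ) + 5 - 1 = k + 4 := by ring
  have e2 : (k : ℝ) + 5 - 2 = k + 3 := by ring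
  rw [e1, e2]
  refine firstZero_lt (by omega) (by positivity) ?_
  push_cast
  rw [← sub_pos]
  have : ∀ x : ℝ, 0 ≤ x → 0 < (x + 5) * (x + 4) / (x + 3) / (x + 5 + 2) +
      ((x + 5) * (x + 4) / (x + 3)) ^ 2 / ((x + 5 + 2) ^ 2 * (x + 5 + 4)) +
      2 * ((x + 5) * (x + 4) / (x + 3)) ^ 3 / ((x + 5 + 2) ^ 3 * (x + 5 + 4) * (x + 5 + 6)) - 1 := by
    intro x hx
    have h3 : x + 3 ≠ 0 := by positivity
    have h7 : x + 5 + 2 ≠ 0 := by positivity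
    have h9 : x + 5 + 4 ≠ 0 := by positivity
    have h11 : x + 5 + 6 ≠ 0 := by positivity
    field_simp
    ring_nf
    positivity
  exact this k hk

/-- The lower bound comes from the Wronskian with the Gaussian `w = r exp (-r² / 2)`, which
satisfies `w'(1) = 0` and the radial equation with `μ` replaced by `N + 2 - r² ≥ N + 1`. -/
lemma add_one_le_firstZero {N : ℕ} (hN : 1 ≤ N) : (N : ℝ) + 1 ≤ firstZero N := by
  obtain ⟨hm0, hm, hpos⟩ := isFirstZero hN
  set μ := firstZero N
  by_contra! hlt
  set W : ℝ → ℝ := fun r => Real.exp (-(r ^ 2 / 2)) *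
    (r ^ N * (slopeSeries N (μ * r ^ 2) - (1 - r ^ 2) * radialSeries N (μ * r ^ 2))) with hW
  have hd : ∀ r, HasDerivAt W (Real.exp (-(r ^ 2 / 2)) *
      (r ^ (N + 1) * ((N + 2 - r ^ 2 - μ) * radialSeries N (μ * r ^ 2)))) r := by
    intro r
    have he : HasDerivAt (fun r : ℝ => Real.exp (-(r ^ 2 / 2)))
        (Real.exp (-(r ^ 2 / 2)) * (-r)) r := by
      refine (((hasDerivAt_pow 2 r).div_const 2).neg.exp).congr_deriv ?_
      norm_num
    have hq : HasDerivAt (fun r : ℝ => 1 - r ^ 2) (-(2 * r)) r := by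
      refine ((hasDerivAt_pow 2 r).const_sub 1).congr_deriv ?_
      norm_num
    refine (he.mul ((hasDerivAt_pow N r).mul ((hasDerivAt_slopeSeries_mul_sq N μ r).sub
      (hq.mul (hasDerivAt_radialSeries_mul_sq N μ r))))).congr_deriv ?_
    obtain ⟨n, rfl⟩ : ∃ n, N = n + 1 := ⟨N - 1, by omega⟩
    have hn : ((n : ℝ) + 1 + 2) ≠ 0 := by positivity
    simp only [Pi.sub_apply, Pi.mul_apply, slopeSeries, Nat.add_sub_cancel]
    push_cast
    field_simp
    ring
  have hmono : StrictMonoOn W (Icc 0 1) := by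
    refine strictMonoOn_of_deriv_pos (convex_Icc _ _)
      (fun r _ => (hd r).continuousAt.continuousWithinAt) fun r hr => ?_
    rw [interior_Icc] at hr
    rw [(hd r).deriv]
    have hr2 : r ^ 2 < 1 := by nlinarith [hr.1, hr.2]
    have hG : 0 < radialSeries N (μ * r ^ 2) :=
      radialSeries_pos_of_slopeSeries_pos (fun s hs => hpos s ⟨hs.1.le, hs.2⟩)
        ⟨by positivity, by nlinarith⟩
    have : 0 < (N : ℝ) + 2 - r ^ 2 - μ := by linarith
    have := hr.1
    positivity
  have h := hmono ⟨le_rfl, zero_le_one⟩ ⟨zero_le_one, le_rfl⟩ one_pos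
  simp [hW, hm, zero_pow (by omega : N ≠ 0)] at h

/-! ### The Laplacian along lines and of radial functions -/

section Laplacian

open scoped RealInnerProductSpace

variable {E : Type*} [NormedAddCommGroup E] [InnerProductSpace ℝ E]

lemma hasDerivAt_line (x v : E) (t : ℝ) : HasDerivAt (fun t : ℝ => x + t • v) v t := by
  simpa using ((hasDerivAt_id t).smul_const v).const_add x

lemma hasDerivAt_norm_sq_line (x v : E) (t : ℝ) :
    HasDerivAt (fun t : ℝ => ‖x + t • v‖ ^ 2) (2 * ⟪x + t • v, v⟫) t :=
  (hasDerivAt_line x v t).norm_sq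

/-- The second derivative along a line, computed from one-variable derivatives. -/
lemma iteratedFDeriv_two_eq_of_hasDerivAt {f : E → ℝ} {x v : E} (hf : ContDiffAt ℝ 2 f x)
    {p : ℝ → ℝ} {q : ℝ} (hp : ∀ᶠ t in 𝓝 (0 : ℝ), HasDerivAt (fun t : ℝ => f (x + t • v)) (p t) t)
    (hq : HasDerivAt p q 0) : iteratedFDeriv ℝ 2 f x ![v, v] = q := by
  rw [iteratedFDeriv_two_apply]
  simp only [Matrix.cons_val_zero, Matrix.cons_val_one]
  have htend : Tendsto (fun t : ℝ => x + t • v) (𝓝 0) (𝓝 x) := by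
    have := (hasDerivAt_line x v 0).continuousAt.tendsto
    simpa using this
  have hdiff : ∀ᶠ y in 𝓝 x, DifferentiableAt ℝ f y :=
    (hf.eventually (by simp)).mono fun y hy => hy.differentiableAt (by simp)
  have hpe : p =ᶠ[𝓝 0] fun t => fderiv ℝ f (x + t • v) v := by
    filter_upwards [hp, htend.eventually hdiff] with t ht hdt
    exact ht.unique (HasFDerivAt.comp_hasDerivAt (f := fun t : ℝ => x + t • v) t
      hdt.hasFDerivAt (hasDerivAt_line x v t))
  have hdd : DifferentiableAt ℝ (fderiv ℝ f) x :=
    (hf.fderiv_right (m := 1) (by norm_num)).differentiableAt (by simp)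
  have hdd' : HasFDerivAt (fderiv ℝ f) (fderiv ℝ (fderiv ℝ f) x) (x + (0 : ℝ) • v) := by
    simpa using hdd.hasFDerivAt
  have h1 : HasDerivAt (fun t : ℝ => fderiv ℝ f (x + t • v) v)
      (fderiv ℝ (fderiv ℝ f) x v v) 0 := by
    have h := HasFDerivAt.comp_hasDerivAt (f := fun t : ℝ => x + t • v) (0 : ℝ) hdd'
      (hasDerivAt_line x v 0)
    have h' := h.clm_apply (hasDerivAt_const (0 : ℝ) v)
    simp only [map_zero, add_zero] at h'
    exact h'
  exact h1.unique (hpe.hasDerivAt_iff.1 hq)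

variable [FiniteDimensional ℝ E]

/-- The Laplacian of a product of an affine function and a radial function. -/
lemma laplacian_affine_mul_radial {K K' : ℝ → ℝ} {K'' : ℝ} (α : ℝ) (e x : E)
    (hK : ContDiffAt ℝ 2 K (‖x‖ ^ 2))
    (hK' : ∀ᶠ s in 𝓝 (‖x‖ ^ 2), HasDerivAt K (K' s) s) (hK'' : HasDerivAt K' K'' (‖x‖ ^ 2)) :
    Laplacian.laplacian (fun y : E => (α + ⟪e, y⟫) * K (‖y‖ ^ 2)) x =
      (α + ⟪e, x⟫) * (4 * ‖x‖ ^ 2 * K'' + 2 * Module.finrank ℝ E * K' (‖x‖ ^ 2))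
        + 4 * ⟪e, x⟫ * K' (‖x‖ ^ 2) := by
  set b := stdOrthonormalBasis ℝ E
  have hcd : ContDiffAt ℝ 2 (fun y : E => (α + ⟪e, y⟫) * K (‖y‖ ^ 2)) x :=
    (contDiffAt_const.add (contDiffAt_const.inner ℝ contDiffAt_id)).mul
      (hK.comp x (contDiff_norm_sq ℝ).contDiffAt)
  have hterm : ∀ i, iteratedFDeriv ℝ 2 (fun y : E => (α + ⟪e, y⟫) * K (‖y‖ ^ 2)) x ![b i, b i] =
      4 * K' (‖x‖ ^ 2) * (⟪e, b i⟫ * ⟪b i, x⟫) + (α + ⟪e, x⟫) *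
        (4 * K'' * (⟪x, b i⟫ * ⟪b i, x⟫) + 2 * K' (‖x‖ ^ 2)) := by
    intro i
    set v := b i
    have hv : ⟪v, v⟫ = 1 := by
      rw [real_inner_self_eq_norm_sq, b.norm_eq_one, one_pow]
    have hlin : ∀ t : ℝ, HasDerivAt (fun t : ℝ => α + ⟪e, x + t • v⟫) ⟪e, v⟫ t := fun t => by
      have := ((hasDerivAt_const t e).inner ℝ (hasDerivAt_line x v t)).const_add α
      simpa using this
    have hlin' : HasDerivAt (fun t : ℝ => 2 * ⟪x + t • v, v⟫) 2 0 := by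
      have := ((hasDerivAt_line x v 0).inner ℝ (hasDerivAt_const (0 : ℝ) v)).const_mul 2
      simpa only [inner_zero_right, zero_add, hv, mul_one] using this
    have htend : Tendsto (fun t : ℝ => ‖x + t • v‖ ^ 2) (𝓝 0) (𝓝 (‖x‖ ^ 2)) := by
      have := (hasDerivAt_norm_sq_line x v 0).continuousAt.tendsto
      simpa using this
    have h0 : ‖x + (0 : ℝ) • v‖ ^ 2 = ‖x‖ ^ 2 := by simp
    have hn := hasDerivAt_norm_sq_line x v 0
    refine iteratedFDeriv_two_eq_of_hasDerivAt hcd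
      (p := fun t => ⟪e, v⟫ * K (‖x + t • v‖ ^ 2) +
        (α + ⟪e, x + t • v⟫) * (K' (‖x + t • v‖ ^ 2) * (2 * ⟪x + t • v, v⟫))) ?_ ?_
    · filter_upwards [htend.eventually hK'] with t ht
      exact (hlin t).mul (HasDerivAt.comp (h := fun t : ℝ => ‖x + t • v‖ ^ 2) t ht
        (hasDerivAt_norm_sq_line x v t))
    · have hKd : HasDerivAt (fun t : ℝ => K (‖x + t • v‖ ^ 2))
          (K' (‖x + (0 : ℝ) • v‖ ^ 2) * (2 * ⟪x + (0 : ℝ) • v, v⟫)) 0 :=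
        HasDerivAt.comp (h := fun t : ℝ => ‖x + t • v‖ ^ 2) 0 (by rw [h0]; exact hK'.self_of_nhds) hn
      have hKd' : HasDerivAt (fun t : ℝ => K' (‖x + t • v‖ ^ 2))
          (K'' * (2 * ⟪x + (0 : ℝ) • v, v⟫)) 0 :=
        HasDerivAt.comp (h := fun t : ℝ => ‖x + t • v‖ ^ 2) 0 (by rw [h0]; exact hK'') hn
      refine ((hKd.const_mul ⟪e, v⟫).add ((hlin 0).mul (hKd'.mul hlin'))).congr_deriv ?_
      simp only [zero_smul, add_zero, real_inner_comm x v, Pi.mul_apply]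
      ring
  rw [InnerProductSpace.laplacian_eq_iteratedFDeriv_orthonormalBasis _ b]
  simp only [hterm]
  rw [Finset.sum_add_distrib, ← Finset.mul_sum, ← Finset.mul_sum, Finset.sum_add_distrib,
    ← Finset.mul_sum, b.sum_inner_mul_inner, b.sum_inner_mul_inner, real_inner_self_eq_norm_sq]
  simp
  ring

/-- The Laplacian of a radial function `F(|y|)`. -/
lemma laplacian_radial {f : E → ℝ} {F F' : ℝ → ℝ} {F'' : ℝ} {x : E} (hx : x ≠ 0)
    (hf : ∀ᶠ y in 𝓝 x, f y = F ‖y‖) (hF : ContDiffAt ℝ 2 F ‖x‖)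
    (hF' : ∀ᶠ r in 𝓝 ‖x‖, HasDerivAt F (F' r) r) (hF'' : HasDerivAt F' F'' ‖x‖) :
    Laplacian.laplacian f x = F'' + ((Module.finrank ℝ E : ℝ) - 1) / ‖x‖ * F' ‖x‖ := by
  have hr : 0 < ‖x‖ := norm_pos_iff.2 hx
  have hsq : √(‖x‖ ^ 2) = ‖x‖ := Real.sqrt_sq hr.le
  have hs0 : ‖x‖ ^ 2 ≠ 0 := by positivity
  have heq : f =ᶠ[𝓝 x] fun y : E => ((1 : ℝ) + ⟪(0 : E), y⟫) * (fun s => F √s) (‖y‖ ^ 2) := by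
    filter_upwards [hf] with y hy
    simp [hy, Real.sqrt_sq]
  rw [(InnerProductSpace.laplacian_congr_nhds heq).self_of_nhds]
  have htend : Tendsto Real.sqrt (𝓝 (‖x‖ ^ 2)) (𝓝 ‖x‖) := by
    have := Real.continuous_sqrt.tendsto (‖x‖ ^ 2)
    rwa [hsq] at this
  have hpos : ∀ᶠ s in 𝓝 (‖x‖ ^ 2), 0 < s := lt_mem_nhds (by positivity)
  rw [laplacian_affine_mul_radial (K := fun s => F √s) (K' := fun s => F' √s * (1 / (2 * √s)))
    (K'' := F'' * (1 / (2 * ‖x‖)) * (1 / (2 * ‖x‖)) + F' ‖x‖ * (-(1 / (4 * ‖x‖ ^ 3))))]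
  · simp only [hsq, inner_zero_left]
    field_simp
    ring
  · exact ContDiffAt.comp (‖x‖ ^ 2) (by rwa [hsq]) (Real.contDiffAt_sqrt hs0)
  · filter_upwards [htend.eventually hF', hpos] with s hs hs1
    exact hs.comp s (Real.hasDerivAt_sqrt hs1.ne')
  · have h1 := Real.hasDerivAt_sqrt hs0
    have h2 : HasDerivAt (fun s => F' √s) (F'' * (1 / (2 * √(‖x‖ ^ 2)))) (‖x‖ ^ 2) :=
      HasDerivAt.comp (‖x‖ ^ 2) (by rwa [hsq]) h1
    have h3 : HasDerivAt (fun s : ℝ => 1 / (2 * √s)) _ (‖x‖ ^ 2) :=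
      (hasDerivAt_const (‖x‖ ^ 2) (1 : ℝ)).div (h1.const_mul 2) (by rw [hsq]; positivity)
    refine (h2.mul h3).congr_deriv ?_
    simp only [hsq]
    field_simp
    ring

lemma laplacian_comp_linearIsometryEquiv (f : E → ℝ) (R : E ≃ₗᵢ[ℝ] E) (x : E) :
    Laplacian.laplacian (fun y => f (R y)) x = Laplacian.laplacian f (R x) := by
  set b := stdOrthonormalBasis ℝ E
  rw [InnerProductSpace.laplacian_eq_iteratedFDeriv_orthonormalBasis _ b,
    InnerProductSpace.laplacian_eq_iteratedFDeriv_orthonormalBasis _ (b.map R)]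
  refine Finset.sum_congr rfl fun i _ => ?_
  have h := R.toContinuousLinearEquiv.iteratedFDerivWithin_comp_right f uniqueDiffOn_univ
    (mem_univ (R x)) 2
  rw [preimage_univ, iteratedFDerivWithin_univ, iteratedFDerivWithin_univ] at h
  have h' : iteratedFDeriv ℝ 2 (fun y => f (R y)) x = _ := h
  rw [h']
  simp only [ContinuousMultilinearMap.compContinuousLinearMap_apply]
  congr 1
  ext j
  fin_cases j <;> rfl

/-- The second derivative test: at an interior maximum the Laplacian is nonpositive. -/
lemma laplacian_nonpos_of_isLocalMax {f : E → ℝ} {x : E} (hf : ContDiffAt ℝ 2 f x)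
    (hmax : IsLocalMax f x) : Laplacian.laplacian f x ≤ 0 := by
  set b := stdOrthonormalBasis ℝ E
  rw [InnerProductSpace.laplacian_eq_iteratedFDeriv_orthonormalBasis _ b]
  refine Finset.sum_nonpos fun i _ => ?_
  set v := b i
  by_contra! hpos
  set k : ℝ → ℝ := fun t => f (x + t • v) with hk
  have hline : ContDiff ℝ 2 fun t : ℝ => x + t • v :=
    contDiff_const.add (contDiff_id.smul contDiff_const)
  have hk2 : ContDiffAt ℝ 2 k 0 := ContDiffAt.comp (0 : ℝ) (by simpa using hf) hline.contDiffAt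
  have hkd : ∀ᶠ t in 𝓝 (0 : ℝ), HasDerivAt k (deriv k t) t :=
    (hk2.eventually (by simp)).mono fun t ht => (ht.differentiableAt (by simp)).hasDerivAt
  have hkdd : DifferentiableAt ℝ (deriv k) 0 :=
    by
    have h : DifferentiableAt ℝ (fderiv ℝ k) 0 :=
      (hk2.fderiv_right (m := 1) (by norm_num)).differentiableAt (by simp)
    exact h.clm_apply (differentiableAt_const (1 : ℝ))
  have hval := iteratedFDeriv_two_eq_of_hasDerivAt hf hkd hkdd.hasDerivAt
  rw [hval] at hpos
  have hkmax : IsLocalMax k 0 := by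
    have ht : Tendsto (fun t : ℝ => x + t • v) (𝓝 0) (𝓝 x) := by
      have := hline.continuous.tendsto 0
      simpa using this
    have := ht.eventually hmax
    simpa [IsLocalMax, IsMaxFilter, hk] using this
  have hkmin := isLocalMin_of_deriv_deriv_pos hpos hkmax.deriv_eq_zero hk2.continuousAt
  -- a point that is both a maximum and a minimum: `k` is locally constant there
  have hconst : k =ᶠ[𝓝 0] fun _ => k 0 := by
    filter_upwards [hkmax, hkmin] with t h1 h2 using le_antisymm h1 h2
  have : deriv (deriv k) 0 = 0 := by
    rw [hconst.deriv.deriv_eq]; simp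
  exact hpos.ne' this

end Laplacian

/-! ### Eigenfunctions below the first zero are radial -/

section Comparison

open scoped RealInnerProductSpace

lemma laplacian_inner_sq {E : Type*} [NormedAddCommGroup E] [InnerProductSpace ℝ E]
    [FiniteDimensional ℝ E] (e x : E) :
    Laplacian.laplacian (fun y : E => ⟪e, y⟫ ^ 2) x = 2 * ‖e‖ ^ 2 := by
  set b := stdOrthonormalBasis ℝ E
  have hcd : ContDiff ℝ 2 (fun y : E => ⟪e, y⟫ ^ 2) := (contDiff_const.inner ℝ contDiff_id).pow 2
  have hterm : ∀ i, iteratedFDeriv ℝ 2 (fun y : E => ⟪e, y⟫ ^ 2) x ![b i, b i] =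
      2 * (⟪e, b i⟫ * ⟪b i, e⟫) := by
    intro i
    have hlin : ∀ t : ℝ, HasDerivAt (fun t : ℝ => ⟪e, x + t • b i⟫) ⟪e, b i⟫ t := fun t => by
      simpa using (hasDerivAt_const t e).inner ℝ (hasDerivAt_line x (b i) t)
    refine iteratedFDeriv_two_eq_of_hasDerivAt hcd.contDiffAt
      (p := fun t => 2 * ⟪e, b i⟫ * ⟪e, x + t • b i⟫) (.of_forall fun t => ?_) ?_
    · refine ((hlin t).pow 2).congr_deriv ?_
      norm_num
      ring
    · refine ((hlin 0).const_mul (2 * ⟪e, b i⟫)).congr_deriv ?_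
      rw [real_inner_comm e (b i)]
      ring
  rw [InnerProductSpace.laplacian_eq_iteratedFDeriv_orthonormalBasis _ b]
  simp only [hterm]
  rw [← Finset.mul_sum, b.sum_inner_mul_inner, real_inner_self_eq_norm_sq]

variable {N : ℕ}

/-- The first angular mode `⟨e, x⟩ G(μ|x|²)` solves the Helmholtz equation on the whole space. -/
lemma laplacian_angularMode (μ : ℝ) (e x : EuclideanSpace ℝ (Fin N)) :
    Laplacian.laplacian
      (fun y : EuclideanSpace ℝ (Fin N) => ⟪e, y⟫ * radialSeries N (μ * ‖y‖ ^ 2)) x =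
      -μ * (⟪e, x⟫ * radialSeries N (μ * ‖x‖ ^ 2)) := by
  have hK : ∀ (M : ℕ) (s : ℝ), HasDerivAt (fun s => radialSeries M (μ * s))
      (-(μ / (2 * ((M : ℝ) + 2))) * radialSeries (M + 2) (μ * s)) s := by
    intro M s
    refine ((hasDerivAt_radialSeries M (μ * s)).comp s
      ((hasDerivAt_id s).const_mul μ)).congr_deriv ?_
    field_simp
  have h := laplacian_affine_mul_radial (K := fun s => radialSeries N (μ * s)) 0 e x
    ((contDiff_radialSeries 2 N).comp (contDiff_const.mul contDiff_id)).contDiffAt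
    (.of_forall (hK N)) ((hK (N + 2) (‖x‖ ^ 2)).const_mul _)
  simp only [zero_add, finrank_euclideanSpace, Fintype.card_fin] at h
  rw [h, radialSeries_recurrence N (μ * ‖x‖ ^ 2)]
  have hN2 : (N : ℝ) + 2 ≠ 0 := by positivity
  have hN4 : (N : ℝ) + 4 ≠ 0 := by positivity
  have e4 : (((N + 2 : ℕ) : ℝ) + 2) = N + 4 := by push_cast; ring
  rw [e4]
  field_simp
  ring

lemma contDiff_angularMode (n : ℕ) (μ : ℝ) (e : EuclideanSpace ℝ (Fin N)) :
    ContDiff ℝ n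
      (fun y : EuclideanSpace ℝ (Fin N) => ⟪e, y⟫ * radialSeries N (μ * ‖y‖ ^ 2)) :=
  (contDiff_const.inner ℝ contDiff_id).mul
    ((contDiff_radialSeries n N).comp (contDiff_const.mul (contDiff_norm_sq ℝ)))

lemma uniqueDiffOn_closedBall : UniqueDiffOn ℝ
    (Metric.closedBall (0 : EuclideanSpace ℝ (Fin N)) 1) :=
  uniqueDiffOn_convex (convex_closedBall _ _)
    ⟨0, Metric.ball_subset_interior_closedBall (Metric.mem_ball_self one_pos)⟩

lemma hasDerivWithinAt_ray_one {μ : ℝ} {f : EuclideanSpace ℝ (Fin N) → ℝ}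
    (hf : IsNeumannEigenfunction N μ f) {x : EuclideanSpace ℝ (Fin N)} (hx : ‖x‖ = 1) :
    HasDerivWithinAt (fun t : ℝ => f (t • x)) 0 (Icc 0 1) 1 := by
  have hd := (hf.contDiffOn_closedBall.differentiableOn (by simp)
    ((1 : ℝ) • x) (by simp [hx])).hasFDerivWithinAt
  have hr : HasDerivWithinAt (fun t : ℝ => t • x) x (Icc 0 1) 1 := by
    simpa using ((hasDerivAt_id (1 : ℝ)).smul_const x).hasDerivWithinAt
  have h := HasFDerivWithinAt.comp_hasDerivWithinAt (f := fun t : ℝ => t • x) (1 : ℝ) hd hr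
    (fun t ht => by
      rw [mem_closedBall_zero_iff, norm_smul, hx, mul_one, Real.norm_eq_abs, abs_of_nonneg ht.1]
      exact ht.2)
  rw [one_smul, hf.boundary x (by simp [hx])] at h
  exact h

/-- The derivative at the right end of `[0, 1]`, where the function is largest, is nonnegative. -/
lemma nonneg_of_hasDerivWithinAt_of_le {ρ : ℝ → ℝ} {d : ℝ}
    (hd : HasDerivWithinAt ρ d (Icc 0 1) 1) (h : ∀ t ∈ Icc (0 : ℝ) 1, ρ t ≤ ρ 1) : 0 ≤ d := by
  have hd' : HasDerivWithinAt ρ d (Iio 1) 1 :=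
    hd.mono_of_mem_nhdsWithin (mem_of_superset (Ioo_mem_nhdsLT zero_lt_one) Ioo_subset_Icc_self)
  rw [hasDerivWithinAt_iff_tendsto_slope' (by simp)] at hd'
  refine ge_of_tendsto hd' ?_
  filter_upwards [Ioo_mem_nhdsLT (zero_lt_one' ℝ)] with t ht
  rw [slope_def_field]
  exact div_nonneg_of_nonpos (by linarith [h t ⟨ht.1.le, ht.2.le⟩]) (by linarith [ht.2])

/-- An eigenfunction for `0 < μ < firstZero N` takes equal values at equal distances from the
origin (the reverse inequality follows by exchanging `x` and `y`). Let `R` be the reflection that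
exchanges `x` and `y`; on the half ball that contains `x`, the odd part `f - f ∘ R` is compared with
the positive strict supersolution `⟨e, x⟩ G(μ|x|²) + ε (1 - μ ⟨e, x⟩²)`, whose normal derivative is
positive off the mirror. The `ε`-term keeps the quotient bounded at the mirror, where it vanishes,
so that its positive maximum is attained elsewhere. -/
lemma IsNeumannEigenfunction.le_of_norm_eq (hN : 1 ≤ N) {μ : ℝ} (hμ : 0 < μ)
    (hμ' : μ < firstZero N) {f : EuclideanSpace ℝ (Fin N) → ℝ}
    (hf : IsNeumannEigenfunction N μ f) {x y : EuclideanSpace ℝ (Fin N)}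
    (hx : x ∈ Metric.ball (0 : EuclideanSpace ℝ (Fin N)) 1) (hxy : ‖x‖ = ‖y‖) : f x ≤ f y := by
  by_contra! hlt
  have hne : x - y ≠ 0 := fun h => by rw [sub_eq_zero.1 h] at hlt; exact hlt.false
  set e : EuclideanSpace ℝ (Fin N) := (‖x - y‖)⁻¹ • (x - y) with he
  set R : EuclideanSpace ℝ (Fin N) ≃ₗᵢ[ℝ] EuclideanSpace ℝ (Fin N) :=
    Submodule.reflection (ℝ ∙ (x - y))ᗮ with hR
  have hRx : R x = y := Submodule.reflection_sub hxy
  have hn0 : 0 < ‖x - y‖ := norm_pos_iff.2 hne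
  have he1 : ‖e‖ = 1 := by
    rw [he, norm_smul, norm_inv, norm_norm, inv_mul_cancel₀ hn0.ne']
  have hex : 0 < ⟪e, x⟫ := by
    rw [he, real_inner_smul_left, inner_sub_left, real_inner_self_eq_norm_sq]
    have h1 : ‖x - y‖ ^ 2 = ‖x‖ ^ 2 - 2 * ⟪x, y⟫ + ‖y‖ ^ 2 := norm_sub_sq_real x y
    rw [← hxy] at h1
    have h2 : 0 < ‖x - y‖ ^ 2 := by positivity
    rw [real_inner_comm]
    have : 0 < ‖x‖ ^ 2 - ⟪x, y⟫ := by linarith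
    positivity
  have hRfix : ∀ z, ⟪e, z⟫ = 0 → R z = z := by
    intro z hz
    rw [hR, Submodule.reflection_eq_self_iff, Submodule.mem_orthogonal_singleton_iff_inner_right]
    rw [he, real_inner_smul_left] at hz
    exact (mul_eq_zero.1 hz).resolve_left (by positivity)
  -- `c` bounds `G` from below; the two bounds on `ε` keep the supersolution and its outer normal
  -- derivative positive
  have hD : 0 < slopeSeries N μ := (isFirstZero hN).2.2 μ ⟨hμ.le, hμ'⟩
  have hGpos : ∀ s ∈ Icc 0 μ, 0 < radialSeries N s := fun s hs =>
    radialSeries_pos_of_slopeSeries_pos (b := firstZero N)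
      (fun s hs => (isFirstZero hN).2.2 s ⟨hs.1.le, hs.2⟩) ⟨hs.1, hs.2.trans hμ'.le⟩
  obtain ⟨s₀, hs₀, hmin⟩ := isCompact_Icc.exists_isMinOn (nonempty_Icc.2 hμ.le)
    (continuous_radialSeries N).continuousOn
  set c := radialSeries N s₀ with hc
  have hc0 : 0 < c := hGpos s₀ hs₀
  obtain ⟨ε, hε, hε1, hε2⟩ : ∃ ε, 0 < ε ∧ ε * μ ≤ c ∧ 2 * ε * μ < slopeSeries N μ := by
    refine ⟨min c (slopeSeries N μ / 4) / μ, by positivity, ?_, ?_⟩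
    · rw [div_mul_cancel₀ _ hμ.ne']; exact min_le_left _ _
    · rw [mul_assoc, div_mul_cancel₀ _ hμ.ne']
      have := min_le_right c (slopeSeries N μ / 4)
      linarith
  set h : EuclideanSpace ℝ (Fin N) → ℝ := fun z => ⟪e, z⟫ * radialSeries N (μ * ‖z‖ ^ 2) with hh
  set H : EuclideanSpace ℝ (Fin N) → ℝ := fun z => h z + ε * (1 - μ * ⟪e, z⟫ ^ 2) with hH
  set g : EuclideanSpace ℝ (Fin N) → ℝ := fun z => f z - f (R z) with hg
  set K : Set (EuclideanSpace ℝ (Fin N)) :=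
    Metric.closedBall 0 1 ∩ {z | 0 ≤ ⟪e, z⟫} with hK
  have hinner : Continuous fun z : EuclideanSpace ℝ (Fin N) => ⟪e, z⟫ :=
    continuous_const.inner continuous_id
  have hKc : IsCompact K := (isCompact_closedBall _ _).inter_right
    (isClosed_le continuous_const hinner)
  have hhcd : ContDiff ℝ 2 h := contDiff_angularMode 2 μ e
  have hqcd : ContDiff ℝ 2 fun z : EuclideanSpace ℝ (Fin N) => ⟪e, z⟫ ^ 2 :=
    (contDiff_const.inner ℝ contDiff_id).pow 2
  have hHcd : ContDiff ℝ 2 H :=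
    hhcd.add (contDiff_const.mul (contDiff_const.sub (contDiff_const.mul hqcd)))
  have hHpos : ∀ z ∈ K, 0 < H z := by
    intro z hz
    have hz1 : ‖z‖ ≤ 1 := mem_closedBall_zero_iff.1 hz.1
    have hz0 : 0 ≤ ⟪e, z⟫ := hz.2
    have hzle : ⟪e, z⟫ ≤ 1 := (real_inner_le_norm e z).trans (by rw [he1, one_mul]; exact hz1)
    have hn : ‖z‖ ^ 2 ≤ 1 := by nlinarith [norm_nonneg z]
    have hGc : c ≤ radialSeries N (μ * ‖z‖ ^ 2) := hmin ⟨by positivity, by nlinarith⟩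
    have h1 : ⟪e, z⟫ * c ≤ h z := mul_le_mul_of_nonneg_left hGc hz0
    have h2 : ε * μ * ⟪e, z⟫ ^ 2 ≤ c * ⟪e, z⟫ := by
      rw [pow_two, ← mul_assoc]
      refine mul_le_mul_of_nonneg_right ?_ hz0
      nlinarith
    simp only [hH]
    linarith
  have hmapsball : ∀ z, ‖R z‖ = ‖z‖ := fun z => R.norm_map z
  have hgc : ContinuousOn g (Metric.closedBall 0 1) := by
    refine hf.contDiffOn_closedBall.continuousOn.sub
      (hf.contDiffOn_closedBall.continuousOn.comp R.continuous.continuousOn fun z hz => ?_)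
    simpa [hmapsball] using hz
  have huc : ContinuousOn (fun z => g z / H z) K :=
    (hgc.mono inter_subset_left).div hHcd.continuous.continuousOn fun z hz => (hHpos z hz).ne'
  have hxK : x ∈ K := ⟨Metric.ball_subset_closedBall hx, hex.le⟩
  obtain ⟨x₀, hx₀, hmax⟩ := hKc.exists_isMaxOn ⟨x, hxK⟩ huc
  set M := g x₀ / H x₀ with hM
  have hM0 : 0 < M := by
    refine lt_of_lt_of_le ?_ (hmax hxK)
    exact div_pos (by simp only [hg, hRx]; linarith) (hHpos x hxK)
  have hle : ∀ z ∈ K, g z - M * H z ≤ 0 := fun z hz => by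
    have := (div_le_iff₀ (hHpos z hz)).1 (hmax hz)
    linarith
  have hgx₀ : g x₀ = M * H x₀ := by rw [hM, div_mul_cancel₀ _ (hHpos x₀ hx₀).ne']
  have hex₀ : 0 < ⟪e, x₀⟫ := by
    refine lt_of_le_of_ne hx₀.2 fun h0 => ?_
    have : g x₀ = 0 := by simp only [hg, hRfix x₀ h0.symm, sub_self]
    rw [hM, this, zero_div] at hM0
    exact hM0.false
  rcases (mem_closedBall_zero_iff.1 hx₀.1).lt_or_eq with hlt1 | heq1
  · -- interior maximum: the Laplacian of `g - M H` would be positive there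
    have hball : x₀ ∈ Metric.ball (0 : EuclideanSpace ℝ (Fin N)) 1 := mem_ball_zero_iff.2 hlt1
    have hRball : R x₀ ∈ Metric.ball (0 : EuclideanSpace ℝ (Fin N)) 1 := by
      rwa [mem_ball_zero_iff, hmapsball]
    have hfcd : ContDiffAt ℝ 2 f x₀ :=
      hf.contDiffOn_ball.contDiffAt (Metric.isOpen_ball.mem_nhds hball)
    have hfRcd : ContDiffAt ℝ 2 (fun z => f (R z)) x₀ :=
      ContDiffAt.comp x₀ (hf.contDiffOn_ball.contDiffAt (Metric.isOpen_ball.mem_nhds hRball))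
        R.contDiff.contDiffAt
    have hloc : IsLocalMax (g - M • H) x₀ := by
      have hnb : K ∈ 𝓝 x₀ := inter_mem
        (mem_of_superset (Metric.isOpen_ball.mem_nhds hball) Metric.ball_subset_closedBall)
        (mem_of_superset ((isOpen_lt continuous_const hinner).mem_nhds hex₀)
          fun z (hz : 0 < ⟪e, z⟫) => hz.le)
      filter_upwards [hnb] with z hz
      have := hle z hz
      simp only [Pi.sub_apply, Pi.smul_apply, smul_eq_mul, hgx₀, sub_self]
      linarith
    have hgcd : ContDiffAt ℝ 2 g x₀ := hfcd.sub hfRcd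
    have hMH : ContDiffAt ℝ 2 (M • H) x₀ := contDiffAt_const.smul hHcd.contDiffAt
    have hlap : Laplacian.laplacian (g - M • H) x₀ ≤ 0 :=
      laplacian_nonpos_of_isLocalMax (hgcd.sub hMH) hloc
    have hlg : Laplacian.laplacian g x₀ = -μ * g x₀ := by
      have h1 : Laplacian.laplacian g x₀ = _ := hfcd.laplacian_sub hfRcd
      rw [h1, laplacian_comp_linearIsometryEquiv]
      have h2 := hf.equation x₀ hball
      have h3 := hf.equation (R x₀) hRball
      simp only [hg]
      linarith
    have hlH : Laplacian.laplacian H x₀ = -μ * h x₀ - 2 * ε * μ := by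
      have hHeq : H = h + ((fun _ => ε) - (ε * μ) • fun z => ⟪e, z⟫ ^ 2) := by
        ext z
        simp only [hH, Pi.add_apply, Pi.sub_apply, Pi.smul_apply, smul_eq_mul]
        ring
      have hq : ContDiffAt ℝ 2 ((ε * μ) • fun z : EuclideanSpace ℝ (Fin N) => ⟪e, z⟫ ^ 2) x₀ :=
        contDiffAt_const.smul hqcd.contDiffAt
      have hεc : ContDiffAt ℝ 2 (fun _ : EuclideanSpace ℝ (Fin N) => ε) x₀ := contDiffAt_const
      have hsub : ContDiffAt ℝ 2 ((fun _ : EuclideanSpace ℝ (Fin N) => ε) -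
          (ε * μ) • fun z : EuclideanSpace ℝ (Fin N) => ⟪e, z⟫ ^ 2) x₀ := hεc.sub hq
      rw [hHeq, hhcd.contDiffAt.laplacian_add hsub, hεc.laplacian_sub hq,
        InnerProductSpace.laplacian_smul _ hqcd.contDiffAt, laplacian_inner_sq,
        InnerProductSpace.laplacian_const, laplacian_angularMode, he1]
      simp only [Pi.zero_apply, smul_eq_mul, hh]
      ring
    rw [hgcd.laplacian_sub hMH, InnerProductSpace.laplacian_smul _ hHcd.contDiffAt, hlg, hlH,
      hgx₀, smul_eq_mul] at hlap
    have : 0 < M * μ * ε * (1 + μ * ⟪e, x₀⟫ ^ 2) := by positivity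
    simp only [hH] at hlap
    linarith
  · -- boundary maximum: the outer derivative of `g - M H` would be negative there
    have hH1 : HasDerivAt (fun t : ℝ => H (t • x₀))
        (⟪e, x₀⟫ * slopeSeries N μ - 2 * ε * μ * ⟪e, x₀⟫ ^ 2) 1 := by
      have h1 : (fun t : ℝ => H (t • x₀)) = fun t =>
          ⟪e, x₀⟫ * radialMode N μ t + ε * (1 - μ * ⟪e, x₀⟫ ^ 2 * t ^ 2) := by
        ext t
        simp only [hH, hh, real_inner_smul_right, norm_smul, heq1, mul_one, Real.norm_eq_abs,
          sq_abs, radialMode]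
        ring
      rw [h1]
      refine (((hasDerivAt_radialMode N μ 1).const_mul _).add
        (((hasDerivAt_mul_sq (μ * ⟪e, x₀⟫ ^ 2) 1).const_sub 1).const_mul ε)).congr_deriv ?_
      rw [one_pow, mul_one]
      ring
    have hg1 : HasDerivWithinAt (fun t : ℝ => g (t • x₀)) (0 - 0) (Icc 0 1) 1 := by
      have h2 := hasDerivWithinAt_ray_one hf (x := R x₀) (by rw [hmapsball, heq1])
      have h3 := (hasDerivWithinAt_ray_one hf heq1).sub h2
      refine h3.congr_of_mem (fun t _ => ?_) (by simp)
      simp only [hg, map_smul, Pi.sub_apply]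
    have hw := nonneg_of_hasDerivWithinAt_of_le (hg1.sub (hH1.const_mul M).hasDerivWithinAt)
      fun t ht => by
        have htK : t • x₀ ∈ K := by
          refine ⟨?_, ?_⟩
          · rw [mem_closedBall_zero_iff, norm_smul, heq1, mul_one, Real.norm_eq_abs,
              abs_of_nonneg ht.1]
            exact ht.2
          · rw [mem_ofPred_eq, real_inner_smul_right]
            exact mul_nonneg ht.1 hex₀.le
        have := hle _ htK
        simp only [Pi.sub_apply, one_smul, hgx₀, sub_self]
        linarith
    have hzle : ⟪e, x₀⟫ ≤ 1 := (real_inner_le_norm e x₀).trans (by rw [he1, one_mul, heq1])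
    have h4 : 2 * ε * μ * ⟪e, x₀⟫ < slopeSeries N μ := by
      have : 0 < 2 * ε * μ := by positivity
      nlinarith
    have h5 : 0 < ⟪e, x₀⟫ * (slopeSeries N μ - 2 * ε * μ * ⟪e, x₀⟫) := by
      have : 0 < slopeSeries N μ - 2 * ε * μ * ⟪e, x₀⟫ := by linarith
      positivity
    nlinarith [mul_pos hM0 h5]

end Comparison

/-! ### Radial eigenfunctions -/

lemma eq_of_hasDerivAt_zero {f : ℝ → ℝ} {a b : ℝ} (hab : a ≤ b) (hf : ContinuousOn f (Icc a b))
    (hd : ∀ r ∈ Ioo a b, HasDerivAt f 0 r) : f a = f b := by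
  rcases hab.eq_or_lt with rfl | hlt
  · rfl
  obtain ⟨c, -, hc⟩ := exists_hasDerivAt_eq_slope f (fun _ => 0) hlt hf hd
  have : b - a ≠ 0 := by linarith
  field_simp at hc
  linarith

/-- There is no positive Neumann eigenvalue below `firstZero N`. An eigenfunction would be radial,
`f = F(|x|)`; its Wronskian with the radial solution `k = φ' + (N - 1) φ / r`, `φ = radialMode N μ`,
for which `k' = -μ φ`, vanishes, so `F` is a multiple of the positive function `k`; at `1`, where
`F'(1) = 0`, the vanishing Wronskian says `F(1) = 0`, and therefore `F = 0`. -/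
lemma IsNeumannEigenfunction.firstZero_le {N : ℕ} (hN : 1 ≤ N) {μ : ℝ} (hμ : 0 < μ)
    {f : EuclideanSpace ℝ (Fin N) → ℝ} (hf : IsNeumannEigenfunction N μ f) : firstZero N ≤ μ := by
  by_contra! hμ'
  set B := Metric.ball (0 : EuclideanSpace ℝ (Fin N)) 1 with hB
  set C := Metric.closedBall (0 : EuclideanSpace ℝ (Fin N)) 1 with hC
  set e : EuclideanSpace ℝ (Fin N) := EuclideanSpace.single ⟨0, hN⟩ 1 with he
  have he1 : ‖e‖ = 1 := by simp [he]
  have hnorm : ∀ r : ℝ, 0 ≤ r → ‖r • e‖ = r := fun r hr => by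
    rw [norm_smul, he1, mul_one, Real.norm_eq_abs, abs_of_nonneg hr]
  have hmemC : ∀ r ∈ Icc (0 : ℝ) 1, r • e ∈ C := fun r hr => by
    rw [hC, mem_closedBall_zero_iff, hnorm r hr.1]; exact hr.2
  have hmemB : ∀ r ∈ Ico (0 : ℝ) 1, r • e ∈ B := fun r hr => by
    rw [hB, mem_ball_zero_iff, hnorm r hr.1]; exact hr.2
  set F : ℝ → ℝ := fun r => f (r • e) with hF
  have hrad : ∀ y ∈ B, f y = F ‖y‖ := fun y hy => by
    have hn : ‖‖y‖ • e‖ = ‖y‖ := hnorm _ (norm_nonneg y)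
    refine le_antisymm (hf.le_of_norm_eq hN hμ hμ' hy hn.symm)
      (hf.le_of_norm_eq hN hμ hμ' ?_ hn)
    exact hmemB _ ⟨norm_nonneg y, mem_ball_zero_iff.1 hy⟩
  set Ψ : ℝ → ℝ := fun r => fderivWithin ℝ f C (r • e) e with hΨ
  have hray : ∀ r : ℝ, HasDerivAt (fun r : ℝ => r • e) e r := fun r => by
    simpa using (hasDerivAt_id r).smul_const e
  have hraycont : Continuous fun r : ℝ => r • e := continuous_id.smul continuous_const
  have hΨc : ContinuousOn Ψ (Icc 0 1) := by
    have h1 := hf.contDiffOn_closedBall.continuousOn_fderivWithin uniqueDiffOn_closedBall (by simp)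
    exact (h1.comp hraycont.continuousOn hmemC).clm_apply continuousOn_const
  have hFc : ContinuousOn F (Icc 0 1) :=
    hf.contDiffOn_closedBall.continuousOn.comp hraycont.continuousOn hmemC
  have hfderiv : ∀ x ∈ B, HasFDerivAt f (fderivWithin ℝ f C x) x := fun x hx =>
    ((hf.contDiffOn_closedBall.differentiableOn (by simp) x
      (Metric.ball_subset_closedBall hx)).hasFDerivWithinAt).hasFDerivAt
      (mem_of_superset (Metric.isOpen_ball.mem_nhds hx) Metric.ball_subset_closedBall)
  have hFd : ∀ r ∈ Ico (0 : ℝ) 1, HasDerivAt F (Ψ r) r := fun r hr =>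
    HasFDerivAt.comp_hasDerivAt (f := fun r : ℝ => r • e) r (hfderiv _ (hmemB r hr)) (hray r)
  have hΨ1 : Ψ 1 = 0 := by
    have h := hf.boundary e (by simp [he1])
    simpa [hΨ] using h
  have hΨ0 : Ψ 0 = 0 := by
    -- `F` extends evenly to negative arguments
    have h1 := hFd 0 ⟨le_rfl, one_pos⟩
    have h2 : HasDerivAt (fun r => F (-r)) (-Ψ 0) 0 := by
      have h3 : HasDerivAt F (Ψ 0) (-0) := by rwa [neg_zero]
      refine (HasDerivAt.comp (0 : ℝ) h3 (hasDerivAt_neg 0)).congr_deriv ?_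
      ring
    have heven : (fun r => F (-r)) =ᶠ[𝓝 0] F := by
      filter_upwards [Ioo_mem_nhds (neg_lt_zero.2 (zero_lt_one' ℝ)) (zero_lt_one' ℝ)] with r hr
      have hb : r • e ∈ B := by
        rw [hB, mem_ball_zero_iff, norm_smul, he1, mul_one]
        exact abs_lt.2 hr
      have hb' : (-r) • e ∈ B := by
        rwa [hB, mem_ball_zero_iff, neg_smul, norm_neg, ← mem_ball_zero_iff]
      change f ((-r) • e) = f (r • e)
      rw [hrad _ hb, hrad _ hb', neg_smul, norm_neg]
    have := h1.unique (heven.hasDerivAt_iff.1 h2)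
    linarith
  have hode : ∀ r ∈ Ioo (0 : ℝ) 1, ∃ Ψ' : ℝ, HasDerivAt Ψ Ψ' r ∧
      Ψ' + ((N : ℝ) - 1) / r * Ψ r + μ * F r = 0 := by
    intro r hr
    have hrB := hmemB r ⟨hr.1.le, hr.2⟩
    have hF2 : ContDiffAt ℝ 2 F r :=
      ContDiffAt.comp r (hf.contDiffOn_ball.contDiffAt (Metric.isOpen_ball.mem_nhds hrB))
        (contDiff_id.smul contDiff_const).contDiffAt
    have hev : ∀ᶠ t in 𝓝 r, HasDerivAt F (Ψ t) t := by
      filter_upwards [Ioo_mem_nhds hr.1 hr.2] with t ht using hFd t ⟨ht.1.le, ht.2⟩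
    have hΨd : HasDerivAt Ψ (deriv (deriv F) r) r := by
      have h : DifferentiableAt ℝ (fderiv ℝ F) r :=
        (hF2.fderiv_right (m := 1) (by norm_num)).differentiableAt (by simp)
      have h' : DifferentiableAt ℝ (deriv F) r := h.clm_apply (differentiableAt_const (1 : ℝ))
      have heq : deriv F =ᶠ[𝓝 r] Ψ := hev.mono fun t ht => ht.deriv
      exact heq.hasDerivAt_iff.1 h'.hasDerivAt
    refine ⟨_, hΨd, ?_⟩
    have hn := hnorm r hr.1.le
    have hlap := laplacian_radial (f := f) (F := F) (F' := Ψ) (x := r • e)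
      (norm_pos_iff.1 (by rw [hn]; exact hr.1))
      (by filter_upwards [Metric.isOpen_ball.mem_nhds hrB] with y hy using hrad y hy)
      (by rwa [hn]) (by rwa [hn]) (by rwa [hn])
    have heq := hf.equation _ hrB
    rw [hlap, hn] at heq
    simpa using heq
  -- `W = r^(N-1) (F' k - F k')` is constant, as both `F` and `k` are radial Helmholtz solutions
  set G : ℝ → ℝ := fun r => radialSeries N (μ * r ^ 2) with hG
  set k : ℝ → ℝ := fun r => slopeSeries N (μ * r ^ 2) + (N - 1) * G r with hk
  have hGd := hasDerivAt_radialSeries_mul_sq N μ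
  have hkd : ∀ r, HasDerivAt k (-(μ * r * G r)) r := fun r => by
    refine ((hasDerivAt_slopeSeries_mul_sq N μ r).add
      ((hGd r).const_mul ((N : ℝ) - 1))).congr_deriv ?_
    have : (N : ℝ) + 2 ≠ 0 := by positivity
    field_simp
    ring
  have hGc : Continuous G := continuous_iff_continuousAt.2 fun r => (hGd r).continuousAt
  have hkc : Continuous k := continuous_iff_continuousAt.2 fun r => (hkd r).continuousAt
  have hmem : ∀ r ∈ Icc (0 : ℝ) 1, μ * r ^ 2 ∈ Ico 0 (firstZero N) := fun r hr =>
    ⟨by positivity, by nlinarith [pow_le_one₀ (n := 2) hr.1 hr.2]⟩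
  have hGpos : ∀ r ∈ Icc (0 : ℝ) 1, 0 < G r := fun r hr =>
    radialSeries_pos_of_slopeSeries_pos (fun s hs => (isFirstZero hN).2.2 s ⟨hs.1.le, hs.2⟩)
      ⟨(hmem r hr).1, (hmem r hr).2.le⟩
  have hkpos : ∀ r ∈ Icc (0 : ℝ) 1, 0 < k r := fun r hr =>
    add_pos_of_pos_of_nonneg ((isFirstZero hN).2.2 _ (hmem r hr))
      (mul_nonneg (sub_nonneg.2 (by exact_mod_cast hN)) (hGpos r hr).le)
  set W : ℝ → ℝ := fun r => r ^ (N - 1) * Ψ r * k r + μ * (r ^ N * G r) * F r with hW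
  have hWc : ContinuousOn W (Icc 0 1) :=
    (((continuous_pow (N - 1)).continuousOn.mul hΨc).mul hkc.continuousOn).add
      ((continuous_const.mul ((continuous_pow N).mul hGc)).continuousOn.mul hFc)
  have hWd : ∀ r ∈ Ioo (0 : ℝ) 1, HasDerivAt W 0 r := by
    intro r hr
    obtain ⟨Ψ', hΨ', hΨeq⟩ := hode r hr
    have hr0 : r ≠ 0 := hr.1.ne'
    obtain ⟨n, rfl⟩ : ∃ n, N = n + 1 := ⟨N - 1, by omega⟩
    have hV : HasDerivAt (fun r => r ^ n * Ψ r) (-(μ * r ^ n * F r)) r := by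
      refine ((hasDerivAt_pow n r).mul hΨ').congr_deriv ?_
      rcases n with _ | n
      · simp at hΨeq ⊢
        linarith
      · have h : Ψ' = -(((n + 1 : ℕ) : ℝ) / r * Ψ r) - μ * F r := by
          push_cast at hΨeq ⊢
          linear_combination hΨeq
        rw [h, Nat.add_sub_cancel]
        push_cast
        field_simp
        ring
    have hU : HasDerivAt (fun r => r ^ (n + 1) * G r) (r ^ n * k r) r := by
      refine ((hasDerivAt_pow (n + 1) r).mul (hGd r)).congr_deriv ?_
      simp only [hk, hG, slopeSeries, Nat.add_sub_cancel]
      push_cast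
      ring
    refine ((hV.mul (hkd r)).add ((hU.const_mul μ).mul (hFd r ⟨hr.1.le, hr.2⟩))).congr_deriv ?_
    ring
  have hW0 : W 0 = 0 := by
    simp only [hW, hΨ0, zero_pow (by omega : N ≠ 0)]
    ring
  have hF1 : F 1 = 0 := by
    have h := eq_of_hasDerivAt_zero zero_le_one hWc hWd
    rw [hW0] at h
    simp only [hW, hΨ1, one_pow] at h
    have h1 : μ * G 1 * F 1 = 0 := by linarith
    exact (mul_eq_zero.1 h1).resolve_left (mul_pos hμ (hGpos 1 ⟨zero_le_one, le_rfl⟩)).ne'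
  have hWz : ∀ r ∈ Icc (0 : ℝ) 1, W r = 0 := fun r hr => by
    rw [← hW0]
    exact (eq_of_hasDerivAt_zero hr.1 (hWc.mono (Icc_subset_Icc_right hr.2))
      fun t ht => hWd t ⟨ht.1, ht.2.trans_le hr.2⟩).symm
  have hFz : ∀ r ∈ Icc (0 : ℝ) 1, F r = 0 := by
    intro r hr
    have hq : F r / k r = F 1 / k 1 := by
      refine eq_of_hasDerivAt_zero (f := fun r => F r / k r) hr.2 ?_ fun t ht => ?_
      · have hsub : Icc r 1 ⊆ Icc 0 1 := Icc_subset_Icc_left hr.1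
        exact (hFc.mono hsub).div hkc.continuousOn fun t ht => (hkpos t (hsub ht)).ne'
      · have ht0 : 0 < t := hr.1.trans_lt ht.1
        have htI : t ∈ Icc (0 : ℝ) 1 := ⟨ht0.le, ht.2.le⟩
        refine ((hFd t ⟨ht0.le, ht.2⟩).div (hkd t) (hkpos t htI).ne').congr_deriv ?_
        have hw : t ^ (N - 1) * (Ψ t * k t - F t * -(μ * t * G t)) = 0 := by
          rw [← hWz t htI]
          obtain ⟨n, rfl⟩ : ∃ n, N = n + 1 := ⟨N - 1, by omega⟩
          simp only [hW, Nat.add_sub_cancel]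
          ring
        rw [(mul_eq_zero.1 hw).resolve_left (by positivity), zero_div]
    rw [hF1, zero_div] at hq
    exact (div_eq_zero_iff.1 hq).resolve_right (hkpos r hr).ne'
  obtain ⟨x, hx, hfx⟩ := hf.nontrivial
  exact hfx (by rw [hrad x hx]; exact hFz _ ⟨norm_nonneg x, (mem_ball_zero_iff.1 hx).le⟩)

/-! ### Eigenfunctions, profiles and the coefficient -/

section Eigenfunctions

open scoped RealInnerProductSpace

variable {N : ℕ}

lemma isNeumannEigenfunction_angularMode (hN : 1 ≤ N) {c : ℝ} (hc : c ≠ 0) (i : Fin N) :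
    IsNeumannEigenfunction N (firstZero N)
      (fun x : EuclideanSpace ℝ (Fin N) =>
        c * radialMode N (firstZero N) ‖x‖ * (x i / ‖x‖)) := by
  obtain ⟨hm0, hm, hpos⟩ := isFirstZero hN
  set m := firstZero N
  set e : EuclideanSpace ℝ (Fin N) := EuclideanSpace.single i 1 with he
  have hei : ∀ x : EuclideanSpace ℝ (Fin N), ⟪e, x⟫ = x i := fun x => by
    simp [he, EuclideanSpace.inner_single_left]
  set h : EuclideanSpace ℝ (Fin N) → ℝ := fun y => ⟪e, y⟫ * radialSeries N (m * ‖y‖ ^ 2) with hh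
  have hfun : (fun x : EuclideanSpace ℝ (Fin N) => c * radialMode N m ‖x‖ * (x i / ‖x‖)) =
      c • h := by
    ext x
    simp only [radialMode, Pi.smul_apply, smul_eq_mul, hh, hei]
    rcases eq_or_ne x 0 with rfl | hx
    · simp
    · have : ‖x‖ ≠ 0 := norm_ne_zero_iff.2 hx
      field_simp
  rw [hfun]
  have hcd : ∀ n : ℕ, ContDiff ℝ n (c • h) := fun n =>
    contDiff_const.smul (contDiff_angularMode n m e)
  refine ⟨⟨(1 / 2 : ℝ) • e, ?_, ?_⟩, (hcd 2).contDiffOn, (hcd 1).contDiffOn, fun x _ => ?_,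
    fun x hx => ?_⟩
  · rw [mem_ball_zero_iff, norm_smul]
    norm_num [he]
  · have hn : ‖(1 / 2 : ℝ) • e‖ = 1 / 2 := by rw [norm_smul]; norm_num [he]
    have hG : 0 < radialSeries N (m * (1 / 2) ^ 2) :=
      radialSeries_pos_of_slopeSeries_pos (fun s hs => hpos s ⟨hs.1.le, hs.2⟩)
        ⟨by positivity, by linarith⟩
    have hee : ⟪e, (1 / 2 : ℝ) • e⟫ = 1 / 2 := by
      rw [real_inner_smul_right, real_inner_self_eq_norm_sq]; norm_num [he]
    simp only [Pi.smul_apply, smul_eq_mul, hh, hn, hee]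
    exact mul_ne_zero hc (mul_ne_zero (by norm_num) hG.ne')
  · rw [InnerProductSpace.laplacian_smul _ (contDiff_angularMode 2 m e).contDiffAt,
      laplacian_angularMode]
    simp only [Pi.smul_apply, smul_eq_mul, hh]
    ring
  · have hx1 : ‖x‖ = 1 := mem_sphere_zero_iff_norm.1 hx
    have hdiff : Differentiable ℝ (c • h) := (hcd 1).differentiable (by simp)
    rw [(hdiff x).fderivWithin (uniqueDiffOn_closedBall x (Metric.sphere_subset_closedBall hx))]
    have h1 : HasDerivAt (fun t : ℝ => (c • h) (t • x)) (fderiv ℝ (c • h) ((1 : ℝ) • x) x) 1 :=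
      HasFDerivAt.comp_hasDerivAt (f := fun t : ℝ => t • x) (1 : ℝ) (hdiff _).hasFDerivAt
        (by simpa using (hasDerivAt_id (1 : ℝ)).smul_const x)
    have h2 : (fun t : ℝ => (c • h) (t • x)) = fun t => c * ⟪e, x⟫ * radialMode N m t := by
      ext t
      simp only [Pi.smul_apply, smul_eq_mul, hh, real_inner_smul_right, norm_smul, hx1, mul_one,
        Real.norm_eq_abs, sq_abs, radialMode]
      ring
    rw [h2, one_smul] at h1
    rw [h1.unique ((hasDerivAt_radialMode N m 1).const_mul _), one_pow, mul_one, hm, mul_zero]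

lemma isLeast_firstZero (hN : 1 ≤ N) : IsLeast (posNeumannEigenvalues N) (firstZero N) :=
  ⟨⟨(isFirstZero hN).1, _, isNeumannEigenfunction_angularMode hN one_ne_zero ⟨0, hN⟩⟩,
    fun _ hμ => hμ.2.elim fun _ hf => hf.firstZero_le hN hμ.1⟩

lemma mu2_eq_firstZero (hN : 1 ≤ N) : mu2 N = firstZero N := (isLeast_firstZero hN).csInf_eq

end Eigenfunctions

section Profile

variable {N : ℕ}

lemma ballVol_pos (N : ℕ) : 0 < ballVol N :=
  ENNReal.toReal_pos (Metric.measure_ball_pos volume _ one_pos).ne' measure_ball_lt_top.ne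

lemma radialMode_pos (hN : 1 ≤ N) {r : ℝ} (hr : r ∈ Ioc (0 : ℝ) 1) :
    0 < radialMode N (firstZero N) r := by
  obtain ⟨hm0, -, hpos⟩ := isFirstZero hN
  exact mul_pos hr.1 (radialSeries_pos_of_slopeSeries_pos (fun s hs => hpos s ⟨hs.1.le, hs.2⟩)
    ⟨by positivity, by nlinarith [pow_le_one₀ (n := 2) hr.1.le hr.2]⟩)

/-- Lommel's integral: the integrand times `2 μ` is the derivative of
`r^N φ'² + (μ r^N - (N - 1) r^(N-2)) φ² + (N - 2) r^(N-1) φ φ'`. -/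
lemma integral_radialMode_sq (hN : 1 ≤ N) :
    2 * firstZero N * ∫ t in (0 : ℝ)..1, radialMode N (firstZero N) t ^ 2 * t ^ (N - 1) =
      (firstZero N - N + 1) * radialMode N (firstZero N) 1 ^ 2 := by
  obtain ⟨hm0, hm, -⟩ := isFirstZero hN
  set m := firstZero N
  set G : ℝ → ℝ := fun r => radialSeries N (m * r ^ 2) with hG
  set D : ℝ → ℝ := fun r => slopeSeries N (m * r ^ 2) with hD
  set R := radialMode N m with hR
  have hd : ∀ r ∈ uIcc (0 : ℝ) 1, HasDerivAt
      (fun r => r ^ N * (D r ^ 2 + m * R r ^ 2 - (N - 1) * G r ^ 2 + (N - 2) * (G r * D r)))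
      (2 * m * (R r ^ 2 * r ^ (N - 1))) r := by
    intro r _
    have hGd := hasDerivAt_radialSeries_mul_sq N m r
    have hDd := hasDerivAt_slopeSeries_mul_sq N m r
    have hRd := hasDerivAt_radialMode N m r
    refine ((hasDerivAt_pow N r).mul ((((hDd.pow 2).add ((hRd.pow 2).const_mul m)).sub
      ((hGd.pow 2).const_mul ((N : ℝ) - 1))).add
      ((hGd.mul hDd).const_mul ((N : ℝ) - 2)))).congr_deriv ?_
    obtain ⟨n, rfl⟩ : ∃ n, N = n + 1 := ⟨N - 1, by omega⟩
    have hn : ((n : ℝ) + 1 + 2) ≠ 0 := by positivity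
    simp only [Pi.sub_apply, Pi.mul_apply, Pi.add_apply, Pi.pow_apply, slopeSeries, hR,
      radialMode, Nat.add_sub_cancel]
    push_cast
    field_simp
    ring
  have hc : Continuous fun r => 2 * m * (R r ^ 2 * r ^ (N - 1)) :=
    continuous_const.mul (((continuous_radialMode N m).pow 2).mul (continuous_pow _))
  have h := intervalIntegral.integral_eq_sub_of_hasDerivAt hd (hc.intervalIntegrable 0 1)
  rw [intervalIntegral.integral_const_mul] at h
  rw [h]
  simp only [hG, hD, hR, radialMode, zero_pow (by omega : N ≠ 0), one_pow, mul_one, hm]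
  ring

lemma exists_isRadialProfile (hN : 1 ≤ N) :
    ∃ c : ℝ, c ≠ 0 ∧ IsRadialProfile N (fun r => c * radialMode N (firstZero N) r) := by
  obtain ⟨hm0, hm, -⟩ := isFirstZero hN
  have hI := integral_radialMode_sq hN
  have hlow := add_one_le_firstZero hN
  have hR1 := radialMode_pos hN (r := 1) ⟨one_pos, le_rfl⟩
  set I := ∫ t in (0 : ℝ)..1, radialMode N (firstZero N) t ^ 2 * t ^ (N - 1) with hIdef
  have hI0 : 0 < I := by
    have : 0 < 2 * firstZero N * I := by
      rw [hI]
      have : 0 < firstZero N - N + 1 := by linarith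
      positivity
    exact pos_of_mul_pos_right this (by positivity)
  have hB := ballVol_pos N
  have hd : ∀ c r : ℝ, HasDerivAt (fun r => c * radialMode N (firstZero N) r)
      (c * slopeSeries N (firstZero N * r ^ 2)) r := fun c r =>
    (hasDerivAt_radialMode N _ r).const_mul c
  set c := 1 / √(ballVol N * I) with hc
  refine ⟨c, by positivity, ⟨?_, ?_, fun t ht => ?_, ?_, ?_, ?_⟩⟩
  · exact (continuous_const.mul (continuous_radialMode N _)).continuousOn
  · exact (contDiff_const.mul (contDiff_radialMode 2 N _)).contDiffOn
  · have h1 : deriv (fun r => c * radialMode N (firstZero N) r) =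
        fun r => c * slopeSeries N (firstZero N * r ^ 2) := funext fun r => (hd c r).deriv
    rw [h1, ((hasDerivAt_slopeSeries_mul_sq N (firstZero N) t).const_mul c).deriv,
      mu2_eq_firstZero hN]
    have ht0 : t ≠ 0 := ht.1.ne'
    have hN2 : (N : ℝ) + 2 ≠ 0 := by positivity
    simp only [slopeSeries, radialMode]
    field_simp
    ring
  · simp [radialMode]
  · have := hd c 1
    rw [one_pow, mul_one, hm, mul_zero] at this
    exact this.hasDerivWithinAt
  · have h1 : ∀ t : ℝ, (c * radialMode N (firstZero N) t) ^ 2 * t ^ (N - 1) =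
        c ^ 2 * (radialMode N (firstZero N) t ^ 2 * t ^ (N - 1)) := fun t => by ring
    simp only [h1]
    rw [intervalIntegral.integral_const_mul, ← hIdef, hc, div_pow, one_pow,
      Real.sq_sqrt (by positivity)]
    field_simp

/-- Every normalized profile is a multiple of the regular mode: the Wronskian of the two is
constant, and it vanishes at `1`, where both derivatives vanish. -/
lemma IsRadialProfile.eq_mul_radialMode (hN : 1 ≤ N) {φ : ℝ → ℝ} (hφ : IsRadialProfile N φ)
    {r : ℝ} (hr : r ∈ Icc (0 : ℝ) 1) :
    φ r = φ 1 / radialMode N (firstZero N) 1 * radialMode N (firstZero N) r := by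
  obtain ⟨hm0, hm, -⟩ := isFirstZero hN
  have hpos := fun r hr => radialMode_pos hN (r := r) hr
  have hode := hφ.equation
  rw [mu2_eq_firstZero hN] at hode
  set m := firstZero N
  set R := radialMode N m with hR
  have hRd : ∀ r, HasDerivAt R (slopeSeries N (m * r ^ 2)) r := hasDerivAt_radialMode N m
  have hRc : Continuous R := continuous_radialMode N m
  have hφd : ∀ t ∈ Ioo (0 : ℝ) 1, HasDerivAt φ (deriv φ t) t ∧
      HasDerivAt (deriv φ) (deriv (deriv φ) t) t := by
    intro t ht
    have h2 : ContDiffAt ℝ 2 φ t := hφ.contDiffOn.contDiffAt (isOpen_Ioo.mem_nhds ht)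
    refine ⟨(h2.differentiableAt (by simp)).hasDerivAt, DifferentiableAt.hasDerivAt ?_⟩
    have h : DifferentiableAt ℝ (fderiv ℝ φ) t :=
      (h2.fderiv_right (m := 1) (by norm_num)).differentiableAt (by simp)
    exact h.clm_apply (differentiableAt_const (1 : ℝ))
  set W : ℝ → ℝ := fun t => t ^ (N - 1) * (φ t * slopeSeries N (m * t ^ 2) - deriv φ t * R t)
    with hW
  have hWd : ∀ t ∈ Ioo (0 : ℝ) 1, HasDerivAt W 0 t := by
    intro t ht
    obtain ⟨h1, h2⟩ := hφd t ht
    have hode := hode t ht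
    have ht0 : t ≠ 0 := ht.1.ne'
    refine ((hasDerivAt_pow (N - 1) t).mul ((h1.mul (hasDerivAt_slopeSeries_mul_sq N m t)).sub
      (h2.mul (hRd t)))).congr_deriv ?_
    have hN2 : (N : ℝ) + 2 ≠ 0 := by positivity
    have h3 : deriv (deriv φ) t = -(((N : ℝ) - 1) / t * deriv φ t)
      - (m - ((N : ℝ) - 1) / t ^ 2) * φ t := by linear_combination hode
    obtain ⟨n, rfl⟩ : ∃ n, N = n + 1 := ⟨N - 1, by omega⟩
    simp only [Pi.sub_apply, Pi.mul_apply, h3, Nat.add_sub_cancel, hR, radialMode, slopeSeries]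
    push_cast at hN2 ⊢
    rcases n with _ | n
    · norm_num at hN2 ⊢
      field_simp
      ring
    · rw [Nat.add_sub_cancel]
      push_cast at hN2 ⊢
      field_simp
      ring
  have hhalf : (1 / 2 : ℝ) ∈ Ioo (0 : ℝ) 1 := ⟨by norm_num, by norm_num⟩
  set C := W (1 / 2) with hC
  have hWC : ∀ t ∈ Ioo (0 : ℝ) 1, W t = C := by
    have key : ∀ a ∈ Ioo (0 : ℝ) 1, ∀ b ∈ Ioo (0 : ℝ) 1, a ≤ b → W a = W b :=
      fun a ha b hb hab => eq_of_hasDerivAt_zero hab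
        (fun t ht =>
          (hWd t ⟨ha.1.trans_le ht.1, ht.2.trans_lt hb.2⟩).continuousAt.continuousWithinAt)
        fun t ht => hWd t ⟨ha.1.trans ht.1, ht.2.trans hb.2⟩
    intro t ht
    rcases le_total t (1 / 2) with h | h
    · exact key t ht _ hhalf h
    · exact (key _ hhalf t ht h).symm
  have hR1 := hpos 1 ⟨one_pos, le_rfl⟩
  have hC0 : C = 0 := by
    have hlt : Ioo (0 : ℝ) 1 ∈ 𝓝[<] (1 : ℝ) := Ioo_mem_nhdsLT zero_lt_one
    have hφt : Tendsto φ (𝓝[<] 1) (𝓝 (φ 1)) :=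
      ((hφ.continuousOn 1 ⟨zero_le_one, le_rfl⟩).mono Ioo_subset_Icc_self).mono_left
        (le_inf nhdsWithin_le_nhds (le_principal_iff.2 hlt))
    have hpow : Tendsto (fun t : ℝ => t ^ (N - 1)) (𝓝[<] 1) (𝓝 1) := by
      have := ((continuous_pow (M := ℝ) (N - 1)).tendsto 1).mono_left
        (nhdsWithin_le_nhds (s := Iio 1))
      rwa [one_pow] at this
    have hslope : Tendsto (fun t : ℝ => slopeSeries N (m * t ^ 2)) (𝓝[<] 1) (𝓝 0) := by
      have h : Tendsto (fun t : ℝ => slopeSeries N (m * t ^ 2)) (𝓝[<] 1)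
          (𝓝 (slopeSeries N (m * 1 ^ 2))) :=
        (hasDerivAt_slopeSeries_mul_sq N m 1).continuousAt.tendsto.mono_left nhdsWithin_le_nhds
      rwa [one_pow, mul_one, hm] at h
    have hRt : Tendsto R (𝓝[<] 1) (𝓝 (R 1)) := (hRc.tendsto 1).mono_left nhdsWithin_le_nhds
    have hlim : Tendsto (deriv φ) (𝓝[<] 1) (𝓝 ((1 * (φ 1 * 0) - C) / (1 * R 1))) := by
      refine (((hpow.mul (hφt.mul hslope)).sub_const C).div (hpow.mul hRt)
        (by rw [one_mul]; exact hR1.ne')).congr' ?_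
      filter_upwards [hlt] with t ht
      have hRt := (hpos t ⟨ht.1, ht.2.le⟩).ne'
      have htp : t ^ (N - 1) ≠ 0 := pow_ne_zero _ ht.1.ne'
      simp only [Pi.div_apply]
      rw [← hWC t ht, div_eq_iff (mul_ne_zero htp hRt)]
      simp only [hW]
      ring
    have h1 := hasDerivWithinAt_Iic_of_tendsto_deriv (s := Ioo (0 : ℝ) 1)
      (fun t ht => (hφd t ht).1.differentiableAt.differentiableWithinAt)
      ((hφ.continuousOn 1 ⟨zero_le_one, le_rfl⟩).mono Ioo_subset_Icc_self) hlt hlim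
    have h2 := (uniqueDiffOn_Icc zero_lt_one 1 ⟨zero_le_one, le_rfl⟩).eq_deriv _
      (h1.mono Icc_subset_Iic_self) hφ.deriv_one
    rw [div_eq_iff (by rw [one_mul]; exact hR1.ne')] at h2
    linarith
  rcases hr.1.eq_or_lt with rfl | hr0
  · rw [hφ.apply_zero]; simp [hR, radialMode]
  have hq : φ r / R r = φ 1 / R 1 := by
    have hsub : Icc r 1 ⊆ Icc 0 1 := Icc_subset_Icc_left hr.1
    refine eq_of_hasDerivAt_zero (f := fun r => φ r / R r) hr.2 ?_ fun t ht => ?_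
    · exact (hφ.continuousOn.mono hsub).div hRc.continuousOn
        fun t ht => (hpos t ⟨hr0.trans_le ht.1, ht.2⟩).ne'
    · have htI : t ∈ Ioo (0 : ℝ) 1 := ⟨hr0.trans ht.1, ht.2⟩
      refine ((hφd t htI).1.div (hRd t) (hpos t ⟨htI.1, htI.2.le⟩).ne').congr_deriv ?_
      have hw : W t = 0 := by rw [hWC t htI, hC0]
      have := (mul_eq_zero.1 hw).resolve_left (pow_ne_zero _ htI.1.ne')
      rw [← neg_sub, this, neg_zero, zero_div]
  rw [← hq, div_mul_cancel₀ _ (hpos r ⟨hr0, hr.2⟩).ne']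

lemma IsRadialProfile.ballVol_mul_sq (hN : 1 ≤ N) {φ : ℝ → ℝ} (hφ : IsRadialProfile N φ) :
    ballVol N * φ 1 ^ 2 = 2 * mu2 N / (mu2 N - N + 1) := by
  have hI := integral_radialMode_sq hN
  have hnorm := hφ.normalized
  have hlow := add_one_le_firstZero hN
  have hR1 := radialMode_pos hN (r := 1) ⟨one_pos, le_rfl⟩
  have hB := ballVol_pos N
  rw [mu2_eq_firstZero hN]
  set a := φ 1 / radialMode N (firstZero N) 1 with ha
  have hcongr : ∫ t in (0 : ℝ)..1, φ t ^ 2 * t ^ (N - 1) =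
      ∫ t in (0 : ℝ)..1, a ^ 2 * (radialMode N (firstZero N) t ^ 2 * t ^ (N - 1)) := by
    refine intervalIntegral.integral_congr fun t ht => ?_
    rw [uIcc_of_le zero_le_one] at ht
    simp only [hφ.eq_mul_radialMode hN ht, ← ha]
    ring
  rw [hcongr, intervalIntegral.integral_const_mul] at hnorm
  have hφ1 : φ 1 = a * radialMode N (firstZero N) 1 := by rw [ha, div_mul_cancel₀ _ hR1.ne']
  have h1 : ballVol N * (a ^ 2 *
      ∫ t in (0 : ℝ)..1, radialMode N (firstZero N) t ^ 2 * t ^ (N - 1)) = 1 := by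
    rw [hnorm]; field_simp
  rw [eq_div_iff (by linarith), hφ1]
  linear_combination 2 * firstZero N * h1 - ballVol N * a ^ 2 * hI

end Profile

section Coefficient

lemma gammaCoeff_eq {N : ℕ} (hN : 1 ≤ N) {φ : ℝ → ℝ} (hφ : IsRadialProfile N φ) :
    gammaCoeff N φ = (2 * mu2 N + ((N : ℝ) + 2) * ((N : ℝ) - 2) -
      ((N : ℝ) + 2) * (2 * mu2 N / (mu2 N - N + 1))) / (6 * (N : ℝ) * ((N : ℝ) + 2) * mu2 N) := by
  rw [gammaCoeff, ← hφ.ballVol_mul_sq hN, mul_assoc ((N : ℝ) + 2)]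

lemma add_one_le_mu2 {N : ℕ} (hN : 1 ≤ N) : (N : ℝ) + 1 ≤ mu2 N := by
  rw [mu2_eq_firstZero hN]; exact add_one_le_firstZero hN

/-- The numerator of `γ_N` has the sign of a quadratic polynomial in `μ₂`, which is negative at `0`
and nonpositive at the upper bound for `μ₂`. -/
lemma quadratic_mu2_neg {N : ℕ} (hN : 2 ≤ N) :
    2 * mu2 N ^ 2 + ((N : ℝ) ^ 2 - 4 * N - 6) * mu2 N - ((N : ℝ) ^ 2 - 4) * ((N : ℝ) - 1) < 0 := by
  have hN1 : 1 ≤ N := by omega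
  have hNr : (2 : ℝ) ≤ N := by exact_mod_cast hN
  have hμ : 0 < mu2 N := by have := add_one_le_mu2 hN1; linarith
  have key : ∀ U : ℝ, mu2 N < U →
      2 * U ^ 2 + ((N : ℝ) ^ 2 - 4 * N - 6) * U - ((N : ℝ) ^ 2 - 4) * ((N : ℝ) - 1) ≤ 0 →
      2 * mu2 N ^ 2 + ((N : ℝ) ^ 2 - 4 * N - 6) * mu2 N
        - ((N : ℝ) ^ 2 - 4) * ((N : ℝ) - 1) < 0 := by
    intro U hU hP
    have hU0 : 0 < U := hμ.trans hU
    have hδ : 0 ≤ ((N : ℝ) ^ 2 - 4) * ((N : ℝ) - 1) := by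
      have : (0 : ℝ) ≤ (N : ℝ) ^ 2 - 4 := by nlinarith
      exact mul_nonneg this (by linarith)
    have h1 : 0 < (U - mu2 N) *
        (2 * mu2 N * U + ((N : ℝ) ^ 2 - 4) * ((N : ℝ) - 1)) :=
      mul_pos (sub_pos.2 hU) (by positivity)
    have h2 := mul_nonpos_of_nonneg_of_nonpos hμ.le hP
    refine neg_of_mul_neg_right (a := U) ?_ hU0.le
    linarith
  rcases le_or_gt N 4 with h4 | h5
  · have hN4 : (N : ℝ) ≤ 4 := by exact_mod_cast h4
    refine key (N + 2) (by rw [mu2_eq_firstZero hN1]; exact firstZero_lt_add_two hN1) ?_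
    nlinarith
  · have hN5 : (5 : ℝ) ≤ N := by exact_mod_cast h5
    refine key _ (by rw [mu2_eq_firstZero hN1]; exact firstZero_lt_div h5) ?_
    have h2 : (N : ℝ) - 2 ≠ 0 := by linarith
    have hval : 2 * ((N : ℝ) * (N - 1) / (N - 2)) ^ 2
        + ((N : ℝ) ^ 2 - 4 * N - 6) * ((N : ℝ) * (N - 1) / (N - 2))
        - ((N : ℝ) ^ 2 - 4) * ((N : ℝ) - 1) = (N - 1) * (16 - 4 * N) / (N - 2) ^ 2 := by
      field_simp
      ring
    rw [hval]
    exact div_nonpos_of_nonpos_of_nonneg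
      (mul_nonpos_of_nonneg_of_nonpos (by linarith) (by linarith)) (by positivity)

lemma gammaCoeff_neg {N : ℕ} (hN : 2 ≤ N) {φ : ℝ → ℝ} (hφ : IsRadialProfile N φ) :
    gammaCoeff N φ < 0 := by
  have hN1 : 1 ≤ N := by omega
  have hNr : (2 : ℝ) ≤ N := by exact_mod_cast hN
  have hlow := add_one_le_mu2 hN1
  have hμ : 0 < mu2 N := by linarith
  have hden : 0 < mu2 N - N + 1 := by linarith
  rw [gammaCoeff_eq hN1 hφ]
  refine div_neg_of_neg_of_pos ?_ (by positivity)
  have hnum : 2 * mu2 N + ((N : ℝ) + 2) * ((N : ℝ) - 2) -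
      ((N : ℝ) + 2) * (2 * mu2 N / (mu2 N - N + 1)) =
      (2 * mu2 N ^ 2 + ((N : ℝ) ^ 2 - 4 * N - 6) * mu2 N
        - ((N : ℝ) ^ 2 - 4) * ((N : ℝ) - 1)) / (mu2 N - N + 1) := by
    field_simp
    ring
  rw [hnum]
  exact div_neg_of_neg_of_pos (quadratic_mu2_neg hN) hden

lemma neg_one_div_le_gammaCoeff {N : ℕ} (hN : 2 ≤ N) {φ : ℝ → ℝ} (hφ : IsRadialProfile N φ) :
    -(1 / (6 * (N : ℝ))) ≤ gammaCoeff N φ := by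
  have hN1 : 1 ≤ N := by omega
  have hNr : (2 : ℝ) ≤ N := by exact_mod_cast hN
  have hlow := add_one_le_mu2 hN1
  have hμ : 0 < mu2 N := by linarith
  have hb : 2 * mu2 N / (mu2 N - N + 1) ≤ mu2 N := by
    rw [div_le_iff₀ (by linarith)]
    nlinarith
  have h1 : ((N : ℝ) + 2) * (2 * mu2 N / (mu2 N - N + 1)) ≤ ((N : ℝ) + 2) * mu2 N :=
    mul_le_mul_of_nonneg_left hb (by positivity)
  have h2 : 0 ≤ ((N : ℝ) + 2) * ((N : ℝ) - 2) := mul_nonneg (by positivity) (by linarith)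
  rw [gammaCoeff_eq hN1 hφ, le_div_iff₀ (by positivity)]
  have h3 : -(1 / (6 * (N : ℝ))) * (6 * (N : ℝ) * ((N : ℝ) + 2) * mu2 N) =
      -(((N : ℝ) + 2) * mu2 N) := by
    field_simp
  rw [h3]
  linarith

end Coefficient

end SzegoWeinberger

theorem lemma2p1 :
    -- the first nontrivial eigenvalue and the normalized radial profile exist, and the profile
    -- yields eigenfunctions
    (∀ N : ℕ, 1 ≤ N →
      IsLeast (SzegoWeinberger.posNeumannEigenvalues N) (SzegoWeinberger.mu2 N) ∧
      ∃ φ : ℝ → ℝ, SzegoWeinberger.IsRadialProfile N φ ∧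
        ∀ i : Fin N, SzegoWeinberger.IsNeumannEigenfunction N (SzegoWeinberger.mu2 N)
          (fun x : EuclideanSpace ℝ (Fin N) => φ ‖x‖ * (x i / ‖x‖))) ∧
    -- (i)
    (∀ N : ℕ, 1 ≤ N → (N : ℝ) + 1 ≤ SzegoWeinberger.mu2 N) ∧
    (∀ N : ℕ, 2 ≤ N → N ≤ 4 → SzegoWeinberger.mu2 N < (N : ℝ) + 2) ∧
    (∀ N : ℕ, 5 ≤ N →
      SzegoWeinberger.mu2 N < (N : ℝ) * ((N : ℝ) - 1) / ((N : ℝ) - 2)) ∧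
    -- (ii)
    (∀ N : ℕ, 1 ≤ N → ∀ φ : ℝ → ℝ, SzegoWeinberger.IsRadialProfile N φ →
      SzegoWeinberger.ballVol N * φ 1 ^ 2 =
        2 * SzegoWeinberger.mu2 N / (SzegoWeinberger.mu2 N - (N : ℝ) + 1)) ∧
    -- (iii)
    (∀ N : ℕ, 2 ≤ N → ∀ φ : ℝ → ℝ, SzegoWeinberger.IsRadialProfile N φ →
      SzegoWeinberger.gammaCoeff N φ < 0) ∧
    -- (iv)
    (∀ φ : ℕ → ℝ → ℝ, (∀ N : ℕ, 2 ≤ N → SzegoWeinberger.IsRadialProfile N (φ N)) →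
      Tendsto (fun N : ℕ => SzegoWeinberger.gammaCoeff N (φ N)) atTop (𝓝 0)) := by
  refine ⟨fun N hN => ⟨?_, ?_⟩, fun N hN => SzegoWeinberger.add_one_le_mu2 hN,
    fun N hN _ => ?_, fun N hN => ?_, fun N hN φ hφ => hφ.ballVol_mul_sq hN,
    fun N hN φ hφ => SzegoWeinberger.gammaCoeff_neg hN hφ, fun φ hφ => ?_⟩
  · rw [SzegoWeinberger.mu2_eq_firstZero hN]
    exact SzegoWeinberger.isLeast_firstZero hN
  · obtain ⟨c, hc, hprof⟩ := SzegoWeinberger.exists_isRadialProfile hN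
    refine ⟨_, hprof, fun i => ?_⟩
    rw [SzegoWeinberger.mu2_eq_firstZero hN]
    exact SzegoWeinberger.isNeumannEigenfunction_angularMode hN hc i
  · have hN1 : 1 ≤ N := by omega
    rw [SzegoWeinberger.mu2_eq_firstZero hN1]
    exact SzegoWeinberger.firstZero_lt_add_two hN1
  · rw [SzegoWeinberger.mu2_eq_firstZero (by omega)]
    exact SzegoWeinberger.firstZero_lt_div hN
  · have hlim : Tendsto (fun N : ℕ => -(1 / (6 * (N : ℝ)))) atTop (𝓝 0) := by
      have h := (tendsto_one_div_atTop_nhds_zero_nat (𝕜 := ℝ)).const_mul (-(1 / 6))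
      rw [mul_zero] at h
      refine h.congr fun N => ?_
      rw [← one_div_mul_one_div]
      ring
    refine tendsto_of_tendsto_of_tendsto_of_le_of_le' hlim tendsto_const_nhds ?_ ?_
    · filter_upwards [eventually_ge_atTop 2] with N hN using
        SzegoWeinberger.neg_one_div_le_gammaCoeff hN (hφ N hN)
    · filter_upwards [eventually_ge_atTop 2] with N hN using
        (SzegoWeinberger.gammaCoeff_neg hN (hφ N hN)).le
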